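/- Let $N\in\mathbb N_0$, let $\Omega\subset\mathbb R^N$ be an open set and let $p\in(1,\infty)$. Let $W^{1,p}(\Omega)$ be the space of all real-valued $u\in L^p(\Omega)$ whose first order distributional partial derivatives $\partial_1u,\dots,\partial_Nu$ belong to $L^p(\Omega)$, with the norm given by $$\|u\|_{W^{1,p}(\Omega)}^p:=\|u\|_{L^p(\Omega)}^p+\sum_{i=1}^N\|\partial_i u\|_{L^p(\Omega)}^p ,$$ and let $\tilde W^{1,p}(\Omega)$ be the closure in $W^{1,p}(\Omega)$ of the set of those functions in $W^{1,p}(\Omega)$ that are restrictions to $\Omega$ of continuous functions $\overline\Omega\to\mathbb R$ with compact support. For $A\subset\overline\Omega$ let $\mathcal Y_{p,\Omega}(A)$ be the set of all $u\in\tilde W^{1,p}(\Omega)$ for which there is a relatively open subset $O$ of $\overline\Omega$ such that $A\subset O$ and $u\ge 1$ almost everywhere on $O\cap\Omega$ (with respect to Lebesgue measure). The relative $p$-capacity of $A$ is $$\mathrm{Cap}_{p,\Omega}(A):=\inf\{\|u\|_{W^{1,p}(\Omega)}^p : u\in\mathcal Y_{p,\Omega}(A)\}\in[0,\infty],\qquad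 \inf\emptyset:=\infty .$$ Then the relative $p$-capacity is countably subadditive: for every sequence $(A_k)_{k\in\mathbb N}$ of subsets of $\overline\Omega$, $$\mathrm{Cap}_{p,\Omega}\Big(\bigcup_{k\in\mathbb N}A_k\Big)\le\sum_{k\in\mathbb N}\mathrm{Cap}_{p,\Omega}(A_k)\in[0,\infty].$$ -/

import Mathlib

open MeasureTheory TopologicalSpace
open scoped ENNReal Distributions CompactlySupported

noncomputable section

namespace RelCap

/-- `ℝ^N` with the Euclidean norm. -/
abbrev RN (N : ℕ) : Type := EuclideanSpace ℝ (Fin N)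

/-- `g` is the `i`-th partial derivative of `u` in the sense of distributions on `Ω`:
`∫_Ω u ∂ᵢφ = - ∫_Ω g φ` for every test function `φ ∈ 𝓓(Ω)`.
Functions on `Ω` are represented by functions on `ℝ^N` whose values outside `Ω` play no role. -/
def HasWeakPartialDeriv {N : ℕ} (Ω : Opens (RN N)) (i : Fin N) (u g : RN N → ℝ) : Prop :=
  ∀ φ : 𝓓(Ω, ℝ),
    ∫ x in (Ω : Set (RN N)), u x * fderiv ℝ φ x (EuclideanSpace.single i 1) =
      - ∫ x in (Ω : Set (RN N)), g x * φ x

/-- `v ∈ L^p(Ω)`. -/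
def MemLpOn {N : ℕ} (Ω : Opens (RN N)) (p : ℝ) (v : RN N → ℝ) : Prop :=
  MemLp v (ENNReal.ofReal p) (volume.restrict (Ω : Set (RN N)))

/-- The Sobolev space `W^{1,p}(Ω)`: functions in `L^p(Ω)` all of whose first order distributional
partial derivatives are in `L^p(Ω)`. -/
def sobolevSpace {N : ℕ} (Ω : Opens (RN N)) (p : ℝ) : Set (RN N → ℝ) :=
  {u | MemLpOn Ω p u ∧ ∀ i, ∃ g, MemLpOn Ω p g ∧ HasWeakPartialDeriv Ω i u g}

open Classical in
/-- The `i`-th distributional partial derivative of `u`, as an element of `L^p(Ω)`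
(a representative of it, which is unique up to null sets; `0` if there is none). -/
def weakPartialDeriv {N : ℕ} (Ω : Opens (RN N)) (p : ℝ) (i : Fin N) (u : RN N → ℝ) : RN N → ℝ :=
  if h : ∃ g, MemLpOn Ω p g ∧ HasWeakPartialDeriv Ω i u g then h.choose else 0

/-- The `p`-th power of the Sobolev norm of `u ∈ W^{1,p}(Ω)`:
`‖u‖_{W^{1,p}(Ω)}^p = ‖u‖_{L^p(Ω)}^p + ∑ᵢ ‖∂ᵢu‖_{L^p(Ω)}^p`. -/
def sobolevNormPow {N : ℕ} (Ω : Opens (RN N)) (p : ℝ) (u : RN N → ℝ) : ℝ≥0∞ :=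
  eLpNorm u (ENNReal.ofReal p) (volume.restrict (Ω : Set (RN N))) ^ p +
    ∑ i, eLpNorm (weakPartialDeriv Ω p i u) (ENNReal.ofReal p)
      (volume.restrict (Ω : Set (RN N))) ^ p

/-- The functions in `W^{1,p}(Ω)` that are restrictions to `Ω` of some function in
`C_c(closure Ω)`. -/
def sobolevCc {N : ℕ} (Ω : Opens (RN N)) (p : ℝ) : Set (RN N → ℝ) :=
  {v | v ∈ sobolevSpace Ω p ∧
    ∃ w : C_c(closure (Ω : Set (RN N)), ℝ),
      ∀ x : closure (Ω : Set (RN N)), (x : RN N) ∈ Ω → v x = w x}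

/-- The closure of `W^{1,p}(Ω) ∩ C_c(closure Ω)` in `W^{1,p}(Ω)`. -/
def sobolevTilde {N : ℕ} (Ω : Opens (RN N)) (p : ℝ) : Set (RN N → ℝ) :=
  {u | u ∈ sobolevSpace Ω p ∧
    ∀ ε : ℝ≥0∞, 0 < ε → ∃ v ∈ sobolevCc Ω p, sobolevNormPow Ω p (u - v) < ε}

/-- The functions admissible for `A ⊆ closure Ω`: those `u` in `sobolevTilde Ω p` for which there
is a relatively open set `O ⊆ closure Ω` containing `A` with `u ≥ 1` a.e. on `O ∩ Ω`. -/
def admissible {N : ℕ} (Ω : Opens (RN N)) (p : ℝ) (A : Set (closure (Ω : Set (RN N)))) :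
    Set (RN N → ℝ) :=
  {u | u ∈ sobolevTilde Ω p ∧
    ∃ O : Set (closure (Ω : Set (RN N))), IsOpen O ∧ A ⊆ O ∧
      ∀ᵐ x : RN N, x ∈ (Subtype.val '' O) ∩ (Ω : Set (RN N)) → 1 ≤ u x}

/-- The relative `p`-capacity of `A ⊆ closure Ω`, with `inf ∅ = ∞`. -/
def relCapacity {N : ℕ} (Ω : Opens (RN N)) (p : ℝ) (A : Set (closure (Ω : Set (RN N)))) : ℝ≥0∞ :=
  ⨅ u ∈ admissible Ω p A, sobolevNormPow Ω p u

end RelCap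

end

/-!
Let `u k` be nonnegative admissible functions for `A k`. Their pointwise supremum `w` dominates
every `u k`, so it is at least `1` near `⋃ k, A k`, and what has to be controlled is its norm and
its membership in `sobolevTilde`.

At almost every point the gradient of a maximum of finitely many functions is the gradient of one of
them. If `∑ k, ‖u k‖ ^ p` is finite then `u k → 0` almost everywhere, so the running maxima
`u 0 ⊔ ⋯ ⊔ u n` are, at almost every point, eventually equal to a single `u k`; their gradients are
then eventually equal to the gradient of that `u k`. The running maxima and their gradients are
dominated by the `ℓ^p` sums of the `u k` and of their gradients, so they converge in norm by
dominated convergence, and `‖w‖ ^ p ≤ ∑ k, ‖u k‖ ^ p`. Since this replaces the usual appeal to weak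
compactness, `p = 1` is included.

The running maxima stay in `sobolevTilde` because `u ↦ u⁺` preserves compactly supported continuous
functions and is continuous for the Sobolev norm.
-/

namespace RelCap

open Filter Topology NNReal Convolution LineDeriv ContinuousLinearMap

section Scheffe

variable {α : Type*} [MeasurableSpace α] {μ : Measure α} {f : ℕ → α → ℝ} {g : α → ℝ}

/-- `|f n - g| = 2 (g - f n)⁺ + (f n - g)`, where the last term integrates to `0` and
`0 ≤ (g - f n)⁺ ≤ g`. -/
theorem tendsto_integral_norm_sub_of_nonneg (hf : ∀ n, Integrable (f n) μ) (hg : Integrable g μ)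
    (hf0 : ∀ n x, 0 ≤ f n x) (hg0 : 0 ≤ g) (hfg : ∀ n, ∫ x, f n x ∂μ = ∫ x, g x ∂μ)
    (hlim : ∀ᵐ x ∂μ, Tendsto (fun n => f n x) atTop (𝓝 (g x))) :
    Tendsto (fun n => ∫ x, ‖f n x - g x‖ ∂μ) atTop (𝓝 0) := by
  have hpos : Tendsto (fun n => ∫ x, (g x - f n x)⁺ ∂μ) atTop (𝓝 (∫ _, (0 : ℝ) ∂μ)) := by
    refine tendsto_integral_of_dominated_convergence g
      (fun n => (hg.sub (hf n)).pos_part.aestronglyMeasurable) hg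
      (fun n => ae_of_all _ fun x => ?_) ?_
    · rw [Real.norm_of_nonneg (posPart_nonneg _), posPart_def]
      exact sup_le (sub_le_self _ (hf0 n x)) (hg0 x)
    · filter_upwards [hlim] with x hx
      simpa [posPart_def] using
        ((tendsto_const_nhds (x := g x)).sub hx).max (tendsto_const_nhds (x := (0 : ℝ)))
  have habs (a b : ℝ) : ‖a - b‖ = 2 * (b - a)⁺ + (a - b) := by
    rw [Real.norm_eq_abs, posPart_def]
    rcases le_total a b with h | h
    · rw [abs_of_nonpos (sub_nonpos.2 h), sup_of_le_left (sub_nonneg.2 h)]; ring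
    · rw [abs_of_nonneg (sub_nonneg.2 h), sup_of_le_right (sub_nonpos.2 h)]; ring
  have heq (n : ℕ) : ∫ x, ‖f n x - g x‖ ∂μ = 2 * ∫ x, (g x - f n x)⁺ ∂μ := by
    have hint : Integrable (fun x => (g x - f n x)⁺) μ := (hg.sub (hf n)).pos_part
    have hsub : Integrable (fun x => f n x - g x) μ := (hf n).sub hg
    simp_rw [habs]
    rw [integral_add (hint.const_mul 2) hsub, integral_const_mul,
      integral_sub (hf n) hg, hfg n, sub_self, add_zero]
  simp_rw [heq]
  simpa using hpos.const_mul 2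

end Scheffe

section Mollification

variable {E : Type*} [NormedAddCommGroup E] [NormedSpace ℝ E] [FiniteDimensional ℝ E]
  [MeasurableSpace E] [BorelSpace E] {μ : Measure E} [μ.IsAddHaarMeasure] {g : E → ℝ}

theorem integrable_normed_convolution (ρ : ContDiffBump (0 : E)) (hg : Integrable g μ) :
    Integrable (ρ.normed μ ⋆[lsmul ℝ ℝ, μ] g) μ :=
  Integrable.integrable_convolution _ ρ.integrable_normed hg

theorem integral_normed_convolution (ρ : ContDiffBump (0 : E)) (hg : Integrable g μ) :
    ∫ x, (ρ.normed μ ⋆[lsmul ℝ ℝ, μ] g) x ∂μ = ∫ x, g x ∂μ := by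
  rw [integral_convolution (lsmul ℝ ℝ) ρ.integrable_normed hg, ρ.integral_normed, lsmul_apply,
    one_smul]

variable {ρ : ℕ → ContDiffBump (0 : E)} {K : ℝ}

theorem tendsto_eLpNorm_normed_convolution_sub_of_nonneg
    (hρ : Tendsto (fun n => (ρ n).rOut) atTop (𝓝 0)) (hK : ∀ n, (ρ n).rOut ≤ K * (ρ n).rIn)
    (hg : Integrable g μ) (hg0 : 0 ≤ g) :
    Tendsto (fun n => eLpNorm ((ρ n).normed μ ⋆[lsmul ℝ ℝ, μ] g - g) 1 μ) atTop (𝓝 0) := by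
  have hnorm : Tendsto (fun n => ∫ x, ‖((ρ n).normed μ ⋆[lsmul ℝ ℝ, μ] g) x - g x‖ ∂μ)
      atTop (𝓝 0) :=
    tendsto_integral_norm_sub_of_nonneg (fun n => integrable_normed_convolution (ρ n) hg) hg
      (fun n x => integral_nonneg fun t => mul_nonneg ((ρ n).nonneg_normed t) (hg0 _)) hg0
      (fun n => integral_normed_convolution (ρ n) hg)
      (ContDiffBump.ae_convolution_tendsto_right_of_locallyIntegrable hρ
        (Eventually.of_forall hK) hg.locallyIntegrable)
  refine (ENNReal.ofReal_zero ▸ ENNReal.tendsto_ofReal hnorm).congr fun n => ?_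
  rw [eLpNorm_one_eq_lintegral_enorm]
  exact ofReal_integral_norm_eq_lintegral_enorm ((integrable_normed_convolution (ρ n) hg).sub hg)

theorem tendsto_eLpNorm_normed_convolution_sub
    (hρ : Tendsto (fun n => (ρ n).rOut) atTop (𝓝 0)) (hK : ∀ n, (ρ n).rOut ≤ K * (ρ n).rIn)
    (hg : Integrable g μ) :
    Tendsto (fun n => eLpNorm ((ρ n).normed μ ⋆[lsmul ℝ ℝ, μ] g - g) 1 μ) atTop (𝓝 0) := by
  have hpos : Integrable g⁺ μ := hg.pos_part
  have hneg : Integrable g⁻ μ := hg.neg_part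
  have hlim := (tendsto_eLpNorm_normed_convolution_sub_of_nonneg hρ hK hpos (posPart_nonneg g)).add
    (tendsto_eLpNorm_normed_convolution_sub_of_nonneg hρ hK hneg (negPart_nonneg g))
  rw [add_zero] at hlim
  refine tendsto_of_tendsto_of_tendsto_of_le_of_le tendsto_const_nhds hlim (fun _ => zero_le)
    fun n => ?_
  have hexists {h : E → ℝ} (hh : Integrable h μ) :
      ConvolutionExists ((ρ n).normed μ) h (lsmul ℝ ℝ) μ :=
    (ρ n).hasCompactSupport_normed.convolutionExists_left _ (ρ n).continuous_normed
      hh.locallyIntegrable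
  have hconv := (hexists hg).distrib_add (hexists hneg)
  have hdecomp : g + g⁻ = g⁺ := (eq_add_of_sub_eq (posPart_sub_negPart g)).symm
  rw [hdecomp] at hconv
  have hsplit : (ρ n).normed μ ⋆[lsmul ℝ ℝ, μ] g - g =
      ((ρ n).normed μ ⋆[lsmul ℝ ℝ, μ] g⁺ - g⁺) - ((ρ n).normed μ ⋆[lsmul ℝ ℝ, μ] g⁻ - g⁻) := by
    rw [hconv, ← hdecomp]; abel
  rw [hsplit]
  exact eLpNorm_sub_le
    ((integrable_normed_convolution (ρ n) hpos).sub hpos).aestronglyMeasurable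
    ((integrable_normed_convolution (ρ n) hneg).sub hneg).aestronglyMeasurable le_rfl

theorem fderiv_normed_convolution_apply (ρ : ContDiffBump (0 : E)) (hg : LocallyIntegrable g μ)
    (x v : E) :
    fderiv ℝ (ρ.normed μ ⋆[lsmul ℝ ℝ, μ] g) x v =
      ∫ t, g t * fderiv ℝ (ρ.normed μ) (x - t) v ∂μ := by
  have hρ : ContDiff ℝ 1 (ρ.normed μ) := ρ.contDiff_normed
  rw [(ρ.hasCompactSupport_normed.hasFDerivAt_convolution_left (lsmul ℝ ℝ) hρ hg x).fderiv]
  change (fderiv ℝ (ρ.normed μ) ⋆[((lsmul ℝ ℝ).flip.precompR E).flip, μ] g) x v = _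
  rw [convolution_flip, convolution_precompR_apply _ hg (ρ.hasCompactSupport_normed.fderiv ℝ)
    (hρ.continuous_fderiv one_ne_zero), convolution_def]
  simp [mul_comm]

end Mollification

section L1Convergence

variable {α : Type*} [MeasurableSpace α] {μ : Measure α} {B H : ℕ → α → ℝ} {b g : α → ℝ} {C : ℝ}

theorem tendsto_integral_mul_of_tendsto_ae_of_tendsto_eLpNorm
    (hB : ∀ n, AEStronglyMeasurable (B n) μ) (hBC : ∀ n x, ‖B n x‖ ≤ C)
    (hBb : ∀ᵐ x ∂μ, Tendsto (fun n => B n x) atTop (𝓝 (b x)))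
    (hH : ∀ n, Integrable (H n) μ) (hg : Integrable g μ)
    (hHg : Tendsto (fun n => eLpNorm (H n - g) 1 μ) atTop (𝓝 0)) :
    Tendsto (fun n => ∫ x, B n x * H n x ∂μ) atTop (𝓝 (∫ x, b x * g x ∂μ)) := by
  have hint (n : ℕ) {w : α → ℝ} (hw : Integrable w μ) : Integrable (fun x => B n x * w x) μ :=
    hw.bdd_mul (hB n) (ae_of_all _ (hBC n))
  have hsmall : Tendsto (fun n => ∫ x, B n x * (H n - g) x ∂μ) atTop (𝓝 (∫ _, (0 : ℝ) ∂μ)) := by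
    refine tendsto_integral_of_L1' _ aestronglyMeasurable_const
      (Eventually.of_forall fun n => hint n ((hH n).sub hg)) ?_
    have hlim : Tendsto (fun n => ENNReal.ofReal C * eLpNorm (H n - g) 1 μ) atTop (𝓝 0) := by
      simpa using ENNReal.Tendsto.const_mul hHg (Or.inr ENNReal.ofReal_ne_top)
    refine tendsto_of_tendsto_of_tendsto_of_le_of_le tendsto_const_nhds hlim (fun _ => zero_le)
      fun n => eLpNorm_le_mul_eLpNorm_of_ae_le_mul (ae_of_all _ fun x => ?_) 1
    rw [Pi.sub_apply, sub_zero, norm_mul]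
    exact mul_le_mul_of_nonneg_right (hBC n x) (norm_nonneg _)
  have hmain : Tendsto (fun n => ∫ x, B n x * g x ∂μ) atTop (𝓝 (∫ x, b x * g x ∂μ)) := by
    refine tendsto_integral_of_dominated_convergence (fun x => C * ‖g x‖)
      (fun n => (hint n hg).aestronglyMeasurable) (hg.norm.const_mul C)
      (fun n => ae_of_all _ fun x => ?_) (hBb.mono fun x hx => hx.mul_const _)
    rw [norm_mul]
    exact mul_le_mul_of_nonneg_right (hBC n x) (norm_nonneg _)
  have hsum := hsmall.add hmain
  rw [integral_zero, zero_add] at hsum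
  refine hsum.congr fun n => ?_
  rw [← integral_add (hint n ((hH n).sub hg)) (hint n hg)]
  simp [mul_sub]

end L1Convergence

section WeakDerivative

variable {N : ℕ} {Ω : Opens (RN N)} {i : Fin N} {u v g : RN N → ℝ}

theorem coe_lineDeriv_testFunction (φ : 𝓓(Ω, ℝ)) (e : RN N) :
    ⇑(∂_{e} φ : 𝓓(Ω, ℝ)) = fun x => fderiv ℝ φ x e := by
  ext x
  rw [TestFunction.lineDerivOp_eq_lineDerivCLM (𝕜 := ℝ),
    TestFunction.lineDerivCLM_apply_of_le (by simp),
    (φ.contDiff.differentiable (by simp)).differentiableAt.lineDeriv_eq_fderiv]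

theorem integrableOn_mul_testFunction (hv : LocallyIntegrableOn v Ω) (φ : 𝓓(Ω, ℝ)) :
    IntegrableOn (fun x => v x * φ x) Ω := by
  simpa [mul_comm] using
    (TestFunction.integrable_bilin (ContinuousLinearMap.mul ℝ ℝ) hv φ).integrableOn

theorem setIntegral_mul_testFunction_eq {S : Set (RN N)} (hSΩ : S ⊆ Ω) {φ : 𝓓(Ω, ℝ)}
    (hφS : tsupport φ ⊆ S) :
    ∫ x in (Ω : Set (RN N)), v x * φ x = ∫ x in S, v x * φ x :=
  setIntegral_eq_of_subset_of_forall_sdiff_eq_zero Ω.isOpen.measurableSet hSΩ fun x hx => by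
    rw [image_eq_zero_of_notMem_tsupport fun h => hx.2 (hφS h), mul_zero]

theorem tsupport_lineDeriv_testFunction_subset (φ : 𝓓(Ω, ℝ)) (e : RN N) :
    tsupport (∂_{e} φ : 𝓓(Ω, ℝ)) ⊆ tsupport φ := by
  rw [coe_lineDeriv_testFunction]
  exact tsupport_fderiv_apply_subset ℝ e

theorem hasWeakPartialDeriv_iff :
    HasWeakPartialDeriv Ω i u g ↔ ∀ φ : 𝓓(Ω, ℝ),
      ∫ x in (Ω : Set (RN N)), u x * (∂_{EuclideanSpace.single i (1 : ℝ)} φ : 𝓓(Ω, ℝ)) x =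
        -∫ x in (Ω : Set (RN N)), g x * φ x := by
  simp_rw [coe_lineDeriv_testFunction, HasWeakPartialDeriv]

theorem hasWeakPartialDeriv_iff_setIntegral_tsupport :
    HasWeakPartialDeriv Ω i u g ↔ ∀ φ : 𝓓(Ω, ℝ),
      ∫ x in tsupport φ, u x * (∂_{EuclideanSpace.single i (1 : ℝ)} φ : 𝓓(Ω, ℝ)) x =
        -∫ x in tsupport φ, g x * φ x := by
  rw [hasWeakPartialDeriv_iff]
  refine forall_congr' fun φ => ?_
  rw [setIntegral_mul_testFunction_eq φ.tsupport_subset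
      (tsupport_lineDeriv_testFunction_subset φ _),
    setIntegral_mul_testFunction_eq φ.tsupport_subset subset_rfl]

theorem HasWeakPartialDeriv.add {u' g' : RN N → ℝ} (h : HasWeakPartialDeriv Ω i u g)
    (h' : HasWeakPartialDeriv Ω i u' g') (hu : LocallyIntegrableOn u Ω)
    (hu' : LocallyIntegrableOn u' Ω) (hg : LocallyIntegrableOn g Ω)
    (hg' : LocallyIntegrableOn g' Ω) : HasWeakPartialDeriv Ω i (u + u') (g + g') := by
  rw [hasWeakPartialDeriv_iff] at h h' ⊢
  intro φ
  simp only [Pi.add_apply, add_mul]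
  rw [integral_add (integrableOn_mul_testFunction hu _) (integrableOn_mul_testFunction hu' _),
    integral_add (integrableOn_mul_testFunction hg φ) (integrableOn_mul_testFunction hg' φ),
    h φ, h' φ, neg_add]

theorem HasWeakPartialDeriv.neg (h : HasWeakPartialDeriv Ω i u g) :
    HasWeakPartialDeriv Ω i (-u) (-g) := by
  intro φ
  simp only [Pi.neg_apply, neg_mul, integral_neg, h φ]

theorem HasWeakPartialDeriv.ae_eq {g' : RN N → ℝ} (h : HasWeakPartialDeriv Ω i u g)
    (h' : HasWeakPartialDeriv Ω i u g') (hg : LocallyIntegrableOn g Ω)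
    (hg' : LocallyIntegrableOn g' Ω) : g =ᵐ[volume.restrict (Ω : Set (RN N))] g' := by
  have hzero : ∀ᵐ x, x ∈ (Ω : Set (RN N)) → (g - g') x = 0 := by
    refine Ω.isOpen.ae_eq_zero_of_integral_contDiff_smul_eq_zero (hg.sub hg')
      fun φ hφ hφc hφΩ => ?_
    let ψ : 𝓓(Ω, ℝ) := ⟨φ, hφ, hφc, hφΩ⟩
    have heq : ∫ x in (Ω : Set (RN N)), g x * ψ x = ∫ x in (Ω : Set (RN N)), g' x * ψ x :=
      neg_injective ((h ψ).symm.trans (h' ψ))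
    have hoff : ∀ x ∉ (Ω : Set (RN N)), φ x • (g - g') x = 0 := fun x hx => by
      rw [image_eq_zero_of_notMem_tsupport fun h => hx (hφΩ h), zero_smul]
    calc ∫ x, φ x • (g - g') x
        = ∫ x in (Ω : Set (RN N)), (g x * ψ x - g' x * ψ x) := by
          rw [← setIntegral_eq_integral_of_forall_compl_eq_zero hoff]
          refine integral_congr_ae (ae_of_all _ fun x => ?_)
          change φ x * (g x - g' x) = g x * φ x - g' x * φ x
          ring
      _ = 0 := by
          rw [integral_sub (integrableOn_mul_testFunction hg ψ)
            (integrableOn_mul_testFunction hg' ψ), heq, sub_self]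
  rw [EventuallyEq, ae_restrict_iff' Ω.isOpen.measurableSet]
  exact hzero.mono fun x hx hxΩ => sub_eq_zero.1 (hx hxΩ)

theorem tendsto_setIntegral_mul_testFunction_of_dominated {v : ℕ → RN N → ℝ} {b : RN N → ℝ}
    (hv : ∀ n, AEStronglyMeasurable (v n) (volume.restrict (Ω : Set (RN N))))
    (hvb : ∀ n, ∀ᵐ x ∂volume.restrict (Ω : Set (RN N)), ‖v n x‖ ≤ b x)
    (hb : LocallyIntegrableOn b Ω)
    (hlim : ∀ᵐ x ∂volume.restrict (Ω : Set (RN N)), Tendsto (fun n => v n x) atTop (𝓝 (u x)))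
    (φ : 𝓓(Ω, ℝ)) :
    Tendsto (fun n => ∫ x in (Ω : Set (RN N)), v n x * φ x) atTop
      (𝓝 (∫ x in (Ω : Set (RN N)), u x * φ x)) := by
  refine tendsto_integral_of_dominated_convergence (fun x => ‖b x * φ x‖)
    (fun n => (hv n).mul φ.aestronglyMeasurable) (integrableOn_mul_testFunction hb φ).norm
    (fun n => (hvb n).mono fun x hx => ?_) (hlim.mono fun x hx => hx.mul_const _)
  rw [norm_mul, norm_mul]
  exact mul_le_mul_of_nonneg_right (hx.trans (le_abs_self _)) (norm_nonneg _)

theorem HasWeakPartialDeriv.of_dominated {v H : ℕ → RN N → ℝ} {b c : RN N → ℝ}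
    (h : ∀ n, HasWeakPartialDeriv Ω i (v n) (H n))
    (hv : ∀ n, AEStronglyMeasurable (v n) (volume.restrict (Ω : Set (RN N))))
    (hH : ∀ n, AEStronglyMeasurable (H n) (volume.restrict (Ω : Set (RN N))))
    (hvb : ∀ n, ∀ᵐ x ∂volume.restrict (Ω : Set (RN N)), ‖v n x‖ ≤ b x)
    (hHc : ∀ n, ∀ᵐ x ∂volume.restrict (Ω : Set (RN N)), ‖H n x‖ ≤ c x)
    (hb : LocallyIntegrableOn b Ω) (hc : LocallyIntegrableOn c Ω)
    (hvu : ∀ᵐ x ∂volume.restrict (Ω : Set (RN N)), Tendsto (fun n => v n x) atTop (𝓝 (u x)))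
    (hHg : ∀ᵐ x ∂volume.restrict (Ω : Set (RN N)), Tendsto (fun n => H n x) atTop (𝓝 (g x))) :
    HasWeakPartialDeriv Ω i u g := by
  simp_rw [hasWeakPartialDeriv_iff] at h ⊢
  exact fun φ => tendsto_nhds_unique
    ((tendsto_setIntegral_mul_testFunction_of_dominated hv hvb hb hvu _).congr fun n => h n φ)
    (tendsto_setIntegral_mul_testFunction_of_dominated hH hHc hc hHg φ).neg

theorem hasWeakPartialDeriv_of_contDiff (hu : ContDiff ℝ 1 u) :
    HasWeakPartialDeriv Ω i u fun x => fderiv ℝ u x (EuclideanSpace.single i 1) := by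
  intro φ
  have hφ : ContDiff ℝ 1 φ := φ.contDiff.of_le (by exact_mod_cast le_top)
  have hdu : Continuous fun x => fderiv ℝ u x (EuclideanSpace.single i 1) :=
    (hu.continuous_fderiv one_ne_zero).clm_apply continuous_const
  have hdφ : Continuous fun x => fderiv ℝ φ x (EuclideanSpace.single i 1) :=
    (hφ.continuous_fderiv one_ne_zero).clm_apply continuous_const
  have hsupp : HasCompactSupport fun x => fderiv ℝ φ x (EuclideanSpace.single i 1) :=
    φ.hasCompactSupport.fderiv_apply ℝ _
  rw [setIntegral_eq_integral_of_forall_compl_eq_zero fun x hx => ?_,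
    setIntegral_eq_integral_of_forall_compl_eq_zero fun x hx => ?_]
  · exact integral_mul_fderiv_eq_neg_fderiv_mul_of_integrable
      ((hdu.mul φ.continuous).integrable_of_hasCompactSupport φ.hasCompactSupport.mul_left)
      ((hu.continuous.mul hdφ).integrable_of_hasCompactSupport hsupp.mul_left)
      ((hu.continuous.mul φ.continuous).integrable_of_hasCompactSupport
        φ.hasCompactSupport.mul_left)
      (fun x _ => (hu.differentiable one_ne_zero).differentiableAt)
      fun x _ => (hφ.differentiable one_ne_zero).differentiableAt
  · rw [image_eq_zero_of_notMem_tsupport fun h => hx (φ.tsupport_subset h), mul_zero]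
  · rw [image_eq_zero_of_notMem_tsupport fun h =>
      hx (φ.tsupport_subset (tsupport_fderiv_apply_subset ℝ _ h)), mul_zero]

end WeakDerivative

section Approximation

variable {N : ℕ} {Ω : Opens (RN N)} {i : Fin N} {u g : RN N → ℝ} {S : Set (RN N)}

theorem tsupport_normed_const_sub_subset {E : Type*} [NormedAddCommGroup E] [NormedSpace ℝ E]
    [FiniteDimensional ℝ E] [MeasurableSpace E] [BorelSpace E] {μ : Measure E}
    [μ.IsAddHaarMeasure] (ρ : ContDiffBump (0 : E)) (x : E) :
    tsupport (fun t => ρ.normed μ (x - t)) ⊆ Metric.closedBall x ρ.rOut := by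
  refine closure_minimal (fun t ht => ?_) Metric.isClosed_closedBall
  have hxt : x - t ∈ Function.support (ρ.normed μ) := ht
  rw [ρ.support_normed_eq, mem_ball_zero_iff, ← dist_eq_norm] at hxt
  exact Metric.mem_closedBall'.2 hxt.le

theorem HasWeakPartialDeriv.fderiv_normed_convolution (h : HasWeakPartialDeriv Ω i u g)
    (hSΩ : S ⊆ Ω) (hS : MeasurableSet S) (hu : IntegrableOn u S) (ρ : ContDiffBump (0 : RN N))
    {x : RN N} (hx : Metric.closedBall x ρ.rOut ⊆ S) :
    fderiv ℝ (ρ.normed volume ⋆[lsmul ℝ ℝ, volume] S.indicator u) x (EuclideanSpace.single i 1) =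
      (ρ.normed volume ⋆[lsmul ℝ ℝ, volume] S.indicator g) x := by
  have hsupp := (tsupport_normed_const_sub_subset (μ := volume) ρ x).trans hx
  let η : 𝓓(Ω, ℝ) := ⟨fun t => ρ.normed volume (x - t),
    ρ.contDiff_normed.comp (contDiff_const.sub contDiff_id),
    (isCompact_closedBall x ρ.rOut).of_isClosed_subset (isClosed_tsupport _)
      (tsupport_normed_const_sub_subset ρ x), hsupp.trans hSΩ⟩
  have hη (t : RN N) : fderiv ℝ η t (EuclideanSpace.single i 1) =
      -fderiv ℝ (ρ.normed volume) (x - t) (EuclideanSpace.single i 1) := by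
    have hρ : Differentiable ℝ (ρ.normed (volume : Measure (RN N))) :=
      (ρ.contDiff_normed (n := 1)).differentiable one_ne_zero
    have hsub : fderiv ℝ (x - ·) t = -ContinuousLinearMap.id ℝ (RN N) :=
      ((hasFDerivAt_id t).const_sub x).fderiv
    change fderiv ℝ (ρ.normed volume ∘ (x - ·)) t _ = _
    rw [fderiv_comp t (hρ _) (by fun_prop), hsub]
    simp
  have hweak := hasWeakPartialDeriv_iff.1 h η
  rw [setIntegral_mul_testFunction_eq hSΩ
      ((tsupport_lineDeriv_testFunction_subset η _).trans hsupp),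
    setIntegral_mul_testFunction_eq hSΩ hsupp,
    ← integral_indicator hS, ← integral_indicator hS, coe_lineDeriv_testFunction] at hweak
  simp_rw [Set.indicator_mul_left S, hη, mul_neg, integral_neg, neg_inj] at hweak
  rw [fderiv_normed_convolution_apply ρ ((integrable_indicator_iff hS).2 hu).locallyIntegrable,
    hweak, convolution_eq_swap]
  exact integral_congr_ae (ae_of_all _ fun t => mul_comm _ _)

theorem exists_contDiffBump_seq (E : Type*) [NormedAddCommGroup E] {r : ℝ} (hr : 0 < r) :
    ∃ ρ : ℕ → ContDiffBump (0 : E), (∀ n, (ρ n).rOut ≤ r) ∧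
      Tendsto (fun n => (ρ n).rOut) atTop (𝓝 0) ∧ ∀ n, (ρ n).rOut ≤ 2 * (ρ n).rIn := by
  refine ⟨fun n => ⟨r / (n + 1) / 2, r / (n + 1), by positivity, half_lt_self (by positivity)⟩,
    fun n => div_le_self hr.le (by linarith [Nat.cast_nonneg (α := ℝ) n]), ?_,
    fun n => (mul_div_cancel₀ _ two_ne_zero).ge⟩
  simpa [div_eq_mul_inv] using
    (tendsto_one_div_add_atTop_nhds_zero_nat (𝕜 := ℝ)).const_mul r

theorem HasWeakPartialDeriv.exists_contDiff_tendsto (h : HasWeakPartialDeriv Ω i u g)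
    (hu : LocallyIntegrableOn u Ω) (hg : LocallyIntegrableOn g Ω) (hS : IsCompact S)
    (hSΩ : S ⊆ Ω) :
    ∃ U : ℕ → RN N → ℝ, (∀ n, ContDiff ℝ 1 (U n)) ∧
      (∀ᵐ x ∂volume.restrict S, Tendsto (fun n => U n x) atTop (𝓝 (u x))) ∧
      Tendsto (fun n => eLpNorm (U n - u) 1 (volume.restrict S)) atTop (𝓝 0) ∧
      Tendsto (fun n => eLpNorm ((fun x => fderiv ℝ (U n) x (EuclideanSpace.single i 1)) - g) 1
        (volume.restrict S)) atTop (𝓝 0) := by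
  obtain ⟨r, hr, hrΩ⟩ := hS.exists_cthickening_subset_open Ω.isOpen hSΩ
  set K := Metric.cthickening r S
  have hK : IsCompact K := hS.cthickening
  have hSK : S ⊆ K := Metric.self_subset_cthickening _
  have hint {w : RN N → ℝ} (hw : LocallyIntegrableOn w Ω) : Integrable (K.indicator w) :=
    (integrable_indicator_iff hK.measurableSet).2 (hw.integrableOn_compact_subset hrΩ hK)
  have heqOn (w : RN N → ℝ) : K.indicator w =ᵐ[volume.restrict S] w :=
    (ae_restrict_mem hS.measurableSet).mono fun x hx => Set.indicator_of_mem (hSK hx) w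
  obtain ⟨ρ, hρr, hρ0, hρ2⟩ := exists_contDiffBump_seq (RN N) hr
  have hlim {w : RN N → ℝ} (hw : LocallyIntegrableOn w Ω) {W : ℕ → RN N → ℝ}
      (hW : ∀ n, ∀ x ∈ S, W n x = ((ρ n).normed volume ⋆[lsmul ℝ ℝ, volume] K.indicator w) x) :
      Tendsto (fun n => eLpNorm (W n - w) 1 (volume.restrict S)) atTop (𝓝 0) := by
    refine tendsto_of_tendsto_of_tendsto_of_le_of_le tendsto_const_nhds
      (tendsto_eLpNorm_normed_convolution_sub hρ0 hρ2 (hint hw)) (fun _ => zero_le) fun n => ?_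
    have hWn : W n =ᵐ[volume.restrict S]
        (ρ n).normed volume ⋆[lsmul ℝ ℝ, volume] K.indicator w :=
      (ae_restrict_mem hS.measurableSet).mono (hW n)
    exact (eLpNorm_congr_ae (hWn.sub (heqOn w).symm)).trans_le
      (eLpNorm_mono_measure _ Measure.restrict_le_self)
  refine ⟨fun n => (ρ n).normed volume ⋆[lsmul ℝ ℝ, volume] K.indicator u, fun n => ?_, ?_,
    hlim hu fun _ _ _ => rfl, hlim hg fun n x hx => ?_⟩
  · exact (ρ n).hasCompactSupport_normed.contDiff_convolution_left _ (ρ n).contDiff_normed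
      (hint hu).locallyIntegrable
  · filter_upwards [heqOn u, ae_restrict_of_ae
      (ContDiffBump.ae_convolution_tendsto_right_of_locallyIntegrable hρ0
        (Eventually.of_forall hρ2) (hint hu).locallyIntegrable)] with x hxu hx
    rwa [hxu] at hx
  · exact h.fderiv_normed_convolution hrΩ hK.measurableSet (hu.integrableOn_compact_subset hrΩ hK)
      (ρ n) ((Metric.closedBall_subset_closedBall (hρr n)).trans
        (Metric.closedBall_subset_cthickening hx r))

end Approximation

section Lipschitz

variable {α : Type*} [MeasurableSpace α] {μ : Measure α} {F : ℝ → ℝ} {C : ℝ≥0} {u : α → ℝ}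

theorem integrable_comp_of_lipschitzWith [IsFiniteMeasure μ] (hF : LipschitzWith C F)
    (hu : Integrable u μ) : Integrable (fun x => F (u x)) μ := by
  refine ((hu.norm.const_mul C).add (integrable_const ‖F 0‖)).mono'
    (hF.continuous.comp_aestronglyMeasurable hu.aestronglyMeasurable) (ae_of_all _ fun x => ?_)
  calc ‖F (u x)‖ ≤ ‖F (u x) - F 0‖ + ‖F 0‖ := norm_le_norm_sub_add _ _
    _ ≤ C * ‖u x‖ + ‖F 0‖ := by simpa using hF.norm_sub_le (u x) 0

theorem tendsto_eLpNorm_comp_sub_of_lipschitzWith (hF : LipschitzWith C F) {p : ℝ≥0∞}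
    {U : ℕ → α → ℝ} (hU : Tendsto (fun n => eLpNorm (U n - u) p μ) atTop (𝓝 0)) :
    Tendsto (fun n => eLpNorm ((fun x => F (U n x)) - fun x => F (u x)) p μ) atTop (𝓝 0) := by
  have hlim : Tendsto (fun n => C • eLpNorm (U n - u) p μ) atTop (𝓝 0) := by
    simpa [ENNReal.smul_def] using ENNReal.Tendsto.const_mul hU (Or.inr ENNReal.coe_ne_top)
  exact tendsto_of_tendsto_of_tendsto_of_le_of_le tendsto_const_nhds hlim (fun _ => zero_le)
    fun n => eLpNorm_le_nnreal_smul_eLpNorm_of_ae_le_mul (ae_of_all _ fun x =>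
      hF.norm_sub_le (U n x) (u x)) p

end Lipschitz

section ChainRule

variable {N : ℕ} {Ω : Opens (RN N)} {i : Fin N} {u g : RN N → ℝ} {F f : ℝ → ℝ} {C : ℝ≥0}

theorem hasWeakPartialDeriv_comp_of_contDiff (hF : ∀ t, HasDerivAt F (f t) t) (hf : Continuous f)
    (hu : ContDiff ℝ 1 u) :
    HasWeakPartialDeriv Ω i (fun x => F (u x))
      (fun x => f (u x) * fderiv ℝ u x (EuclideanSpace.single i 1)) := by
  have hF1 : ContDiff ℝ 1 F := contDiff_one_iff_deriv.2 ⟨fun t => (hF t).differentiableAt,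
    (funext fun t => (hF t).deriv : deriv F = f) ▸ hf⟩
  have hderiv (x : RN N) : fderiv ℝ (fun x => F (u x)) x = f (u x) • fderiv ℝ u x :=
    ((hF (u x)).comp_hasFDerivAt x (hu.differentiable one_ne_zero x).hasFDerivAt).fderiv
  have hcomp := hasWeakPartialDeriv_of_contDiff (Ω := Ω) (i := i) (u := fun x => F (u x))
    (hF1.comp hu)
  simpa only [hderiv, smul_apply, smul_eq_mul] using hcomp

theorem HasWeakPartialDeriv.comp (h : HasWeakPartialDeriv Ω i u g)
    (hu : LocallyIntegrableOn u Ω) (hg : LocallyIntegrableOn g Ω)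
    (hF : ∀ t, HasDerivAt F (f t) t) (hf : Continuous f) (hfC : ∀ t, ‖f t‖₊ ≤ C) :
    HasWeakPartialDeriv Ω i (fun x => F (u x)) (fun x => f (u x) * g x) := by
  rw [hasWeakPartialDeriv_iff_setIntegral_tsupport]
  intro φ
  set ψ : 𝓓(Ω, ℝ) := ∂_{EuclideanSpace.single i (1 : ℝ)} φ
  set S := tsupport φ
  have hS : IsCompact S := φ.hasCompactSupport
  have hSΩ : S ⊆ Ω := φ.tsupport_subset
  have hS_fin : IsFiniteMeasure (volume.restrict S) := ⟨by simpa using hS.measure_lt_top⟩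
  have hFlip : LipschitzWith C F := lipschitzWith_of_nnnorm_deriv_le
    (fun t => (hF t).differentiableAt) fun t => (hF t).deriv ▸ hfC t
  obtain ⟨U, hU, hUu, hUu1, hUg1⟩ := h.exists_contDiff_tendsto hu hg hS hSΩ
  obtain ⟨D, hD⟩ := ψ.continuous.bounded_above_of_compact_support ψ.hasCompactSupport
  obtain ⟨D', hD'⟩ := φ.continuous.bounded_above_of_compact_support φ.hasCompactSupport
  have hleft : Tendsto (fun n => ∫ x in S, ψ x * F (U n x)) atTop
      (𝓝 (∫ x in S, ψ x * F (u x))) :=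
    tendsto_integral_mul_of_tendsto_ae_of_tendsto_eLpNorm (fun _ => ψ.aestronglyMeasurable)
      (fun _ => hD) (ae_of_all _ fun _ => tendsto_const_nhds)
      (fun n => (hFlip.continuous.comp (hU n).continuous).continuousOn.integrableOn_compact hS)
      (integrable_comp_of_lipschitzWith hFlip (hu.integrableOn_compact_subset hSΩ hS))
      (tendsto_eLpNorm_comp_sub_of_lipschitzWith hFlip hUu1)
  have hright : Tendsto (fun n => ∫ x in S, φ x * f (U n x) *
      fderiv ℝ (U n) x (EuclideanSpace.single i 1)) atTop
      (𝓝 (∫ x in S, φ x * f (u x) * g x)) := by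
    refine tendsto_integral_mul_of_tendsto_ae_of_tendsto_eLpNorm (C := D' * C)
      (fun n => (φ.continuous.mul (hf.comp (hU n).continuous)).aestronglyMeasurable)
      (fun n x => ?_) (hUu.mono fun x hx => ((hf.tendsto _).comp hx).const_mul _) (fun n => ?_)
      (hg.integrableOn_compact_subset hSΩ hS) hUg1
    · rw [norm_mul]
      exact mul_le_mul (hD' x) (hfC _) (norm_nonneg _) ((norm_nonneg _).trans (hD' x))
    · exact (((hU n).continuous_fderiv one_ne_zero).clm_apply
        continuous_const).continuousOn.integrableOn_compact hS
  have hsmooth (n : ℕ) : ∫ x in S, ψ x * F (U n x) =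
      -∫ x in S, φ x * f (U n x) * fderiv ℝ (U n) x (EuclideanSpace.single i 1) := by
    simpa only [mul_comm, mul_left_comm] using hasWeakPartialDeriv_iff_setIntegral_tsupport.1
      (hasWeakPartialDeriv_comp_of_contDiff (Ω := Ω) (i := i) hF hf (hU n)) φ
  simpa only [mul_comm, mul_left_comm, mul_assoc] using
    tendsto_nhds_unique (hleft.congr hsmooth) hright.neg

theorem HasWeakPartialDeriv.intervalIntegral_comp_of_tendsto {f : ℕ → ℝ → ℝ} {f₀ : ℝ → ℝ}
    (h : HasWeakPartialDeriv Ω i u g)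
    (hu : LocallyIntegrableOn u Ω) (hg : LocallyIntegrableOn g Ω)
    (hf : ∀ n, Continuous (f n)) (hfC : ∀ n t, ‖f n t‖₊ ≤ C)
    (hlim : ∀ t, Tendsto (fun n => f n t) atTop (𝓝 (f₀ t))) :
    HasWeakPartialDeriv Ω i (fun x => ∫ t in (0 : ℝ)..u x, f₀ t) (fun x => f₀ (u x) * g x) := by
  have hFint (n : ℕ) (t : ℝ) : HasDerivAt (fun s => ∫ t in (0 : ℝ)..s, f n t) (f n t) t :=
    ((hf n).integral_hasStrictDerivAt 0 t).hasDerivAt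
  have hFcont (n : ℕ) : Continuous fun s => ∫ t in (0 : ℝ)..s, f n t :=
    continuous_iff_continuousAt.2 fun t => (hFint n t).continuousAt
  refine HasWeakPartialDeriv.of_dominated (b := fun x => C * ‖u x‖) (c := fun x => C * ‖g x‖)
    (fun n => h.comp hu hg (hFint n) (hf n) (hfC n))
    (fun n => (hFcont n).comp_aestronglyMeasurable hu.aestronglyMeasurable)
    (fun n => ((hf n).comp_aestronglyMeasurable hu.aestronglyMeasurable).mul
      hg.aestronglyMeasurable)
    (fun n => ae_of_all _ fun x => ?_) (fun n => ae_of_all _ fun x => ?_)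
    (hu.norm.smul (C : ℝ)) (hg.norm.smul (C : ℝ)) (ae_of_all _ fun x => ?_)
    (ae_of_all _ fun x => (hlim (u x)).mul_const _)
  · simpa using intervalIntegral.norm_integral_le_of_norm_le_const (a := 0) (b := u x)
      fun t _ => hfC n t
  · rw [norm_mul]
    exact mul_le_mul_of_nonneg_right (hfC n _) (norm_nonneg _)
  · exact intervalIntegral.tendsto_integral_filter_of_dominated_convergence (fun _ => (C : ℝ))
      (Eventually.of_forall fun n => (hf n).aestronglyMeasurable)
      (Eventually.of_forall fun n => ae_of_all _ fun t _ => hfC n t)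
      intervalIntegrable_const (ae_of_all _ fun t _ => hlim t)

theorem tendsto_smoothTransition_nat_mul (t : ℝ) :
    Tendsto (fun n : ℕ => Real.smoothTransition (n * t)) atTop
      (𝓝 ((Set.Ioi 0).indicator 1 t)) := by
  rcases le_or_gt t 0 with ht | ht
  · simp [Real.smoothTransition.zero_of_nonpos
      (mul_nonpos_of_nonneg_of_nonpos (Nat.cast_nonneg _) ht), Set.notMem_Ioi.2 ht]
  · rw [Set.indicator_of_mem (Set.mem_Ioi.2 ht)]
    refine tendsto_const_nhds.congr' ?_
    filter_upwards [(tendsto_natCast_atTop_atTop.atTop_mul_const ht).eventually_ge_atTop 1]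
      with n hn
    exact (Real.smoothTransition.one_of_one_le hn).symm

theorem intervalIntegral_indicator_Ioi_zero (s : ℝ) :
    ∫ t in (0 : ℝ)..s, (Set.Ioi 0).indicator (1 : ℝ → ℝ) t = s⁺ := by
  rcases le_total 0 s with hs | hs
  · have hone : Set.EqOn ((Set.Ioi 0).indicator (1 : ℝ → ℝ)) 1 (Set.Ioc 0 s) :=
      fun t ht => Set.indicator_of_mem ht.1 1
    rw [posPart_of_nonneg hs, intervalIntegral.integral_of_le hs,
      setIntegral_congr_fun measurableSet_Ioc hone]
    simp [hs]
  · have hzero : Set.EqOn ((Set.Ioi 0).indicator (1 : ℝ → ℝ)) 0 (Set.Ioc s 0) :=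
      fun t ht => Set.indicator_of_notMem (Set.notMem_Ioi.2 ht.2) 1
    rw [posPart_of_nonpos hs, intervalIntegral.integral_of_ge hs,
      setIntegral_congr_fun measurableSet_Ioc hzero]
    simp

theorem HasWeakPartialDeriv.posPart (h : HasWeakPartialDeriv Ω i u g)
    (hu : LocallyIntegrableOn u Ω) (hg : LocallyIntegrableOn g Ω) :
    HasWeakPartialDeriv Ω i u⁺ ({x | 0 < u x}.indicator g) := by
  have hbdd (n : ℕ) (t : ℝ) : ‖Real.smoothTransition (n * t)‖₊ ≤ 1 := by
    rw [← NNReal.coe_le_coe, coe_nnnorm, Real.norm_of_nonneg (Real.smoothTransition.nonneg _)]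
    exact Real.smoothTransition.le_one _
  have hpos := h.intervalIntegral_comp_of_tendsto hu hg
    (fun n => Real.smoothTransition.continuous.comp (continuous_const_mul (n : ℝ))) hbdd
    tendsto_smoothTransition_nat_mul
  simp_rw [intervalIntegral_indicator_Ioi_zero] at hpos
  have hindicator : {x | 0 < u x}.indicator g =
      fun x => (Set.Ioi 0).indicator (1 : ℝ → ℝ) (u x) * g x := by
    ext x
    by_cases hx : 0 < u x <;> simp [hx]
  rwa [hindicator]

end ChainRule

section PowerIntegral

variable {α : Type*} [MeasurableSpace α] {μ : Measure α} {p : ℝ}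

theorem eLpNorm_ofReal_rpow (hp : 0 < p) (f : α → ℝ) :
    eLpNorm f (ENNReal.ofReal p) μ ^ p = ∫⁻ x, ‖f x‖ₑ ^ p ∂μ := by
  rw [eLpNorm_eq_eLpNorm' (by simpa using hp) ENNReal.ofReal_ne_top, ENNReal.toReal_ofReal hp.le,
    ← lintegral_rpow_enorm_eq_rpow_eLpNorm' hp]

theorem lintegral_enorm_rpow_ne_top (hp : 0 < p) {f : α → ℝ} (hf : MemLp f (ENNReal.ofReal p) μ) :
    ∫⁻ x, ‖f x‖ₑ ^ p ∂μ ≠ ∞ := by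
  rw [← eLpNorm_ofReal_rpow hp]
  exact ENNReal.rpow_ne_top_of_nonneg hp.le hf.2.ne

theorem tendsto_rpow_zero {ι : Type*} {l : Filter ι} {a : ι → ℝ≥0∞} (hp : 0 < p)
    (ha : Tendsto a l (𝓝 0)) : Tendsto (fun i => a i ^ p) l (𝓝 0) :=
  (ENNReal.continuous_rpow_const.tendsto' 0 0 (ENNReal.zero_rpow_of_pos hp)).comp ha

theorem tendsto_zero_of_tendsto_rpow_zero {ι : Type*} {l : Filter ι} {a : ι → ℝ≥0∞} (hp : 0 < p)
    (ha : Tendsto (fun i => a i ^ p) l (𝓝 0)) : Tendsto a l (𝓝 0) := by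
  simpa only [ENNReal.rpow_rpow_inv hp.ne'] using tendsto_rpow_zero (inv_pos.2 hp) ha

theorem two_rpow_sub_one_ne_top (hp : 1 ≤ p) : (2 : ℝ≥0∞) ^ (p - 1) ≠ ∞ :=
  ENNReal.rpow_ne_top_of_nonneg (sub_nonneg.2 hp) ENNReal.ofNat_ne_top

theorem lintegral_enorm_add_rpow_le (hp : 1 ≤ p) {f g : α → ℝ} (hf : AEStronglyMeasurable f μ) :
    ∫⁻ x, ‖f x + g x‖ₑ ^ p ∂μ ≤
      2 ^ (p - 1) * (∫⁻ x, ‖f x‖ₑ ^ p ∂μ + ∫⁻ x, ‖g x‖ₑ ^ p ∂μ) := by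
  have hp0 : 0 ≤ p := by positivity
  rw [← lintegral_add_left' (hf.enorm.pow_const p),
    ← lintegral_const_mul' _ _ (two_rpow_sub_one_ne_top hp)]
  exact lintegral_mono fun x => (ENNReal.rpow_le_rpow (enorm_add_le _ _) hp0).trans
    (ENNReal.rpow_add_le_mul_rpow_add_rpow _ _ hp)

theorem tendsto_lintegral_enorm_sub_rpow_of_dominated (hp : 0 < p) {F : ℕ → α → ℝ}
    {f b : α → ℝ} (hF : ∀ n, AEStronglyMeasurable (F n) μ) (hb : MemLp b (ENNReal.ofReal p) μ)
    (hFb : ∀ n, ∀ᵐ x ∂μ, ‖F n x‖ ≤ b x)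
    (hlim : ∀ᵐ x ∂μ, Tendsto (fun n => F n x) atTop (𝓝 (f x))) :
    Tendsto (fun n => ∫⁻ x, ‖f x - F n x‖ₑ ^ p ∂μ) atTop (𝓝 0) := by
  have hfb : ∀ᵐ x ∂μ, ‖f x‖ ≤ b x := by
    filter_upwards [ae_all_iff.2 hFb, hlim] with x hx hxlim
    exact le_of_tendsto hxlim.norm (Eventually.of_forall hx)
  have hmeas (n : ℕ) : AEMeasurable (fun x => ‖f x - F n x‖ₑ ^ p) μ :=
    (((aestronglyMeasurable_of_tendsto_ae atTop hF hlim).sub (hF n)).enorm.pow_const p)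
  have hzero : ∀ᵐ x ∂μ, Tendsto (fun n => ‖f x - F n x‖ₑ ^ p) atTop (𝓝 0) := by
    filter_upwards [hlim] with x hx
    exact tendsto_rpow_zero hp (by simpa using (hx.const_sub (f x)).enorm)
  simpa using tendsto_lintegral_of_dominated_convergence' (fun x => ‖((2 : ℝ) • b) x‖ₑ ^ p) hmeas
    (fun n => by
      filter_upwards [hFb n, hfb] with x hFx hfx
      refine ENNReal.rpow_le_rpow (enorm_le_iff_norm_le.2 ?_) hp.le
      calc ‖f x - F n x‖ ≤ b x + b x := (norm_sub_le _ _).trans (add_le_add hfx hFx)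
        _ = ((2 : ℝ) • b) x := by simp [two_mul]
        _ ≤ ‖((2 : ℝ) • b) x‖ := le_abs_self _)
    (lintegral_enorm_rpow_ne_top hp (hb.const_smul (2 : ℝ))) hzero

theorem ae_tendsto_zero_of_tsum_lintegral_enorm_rpow_ne_top (hp : 0 < p) {f : ℕ → α → ℝ}
    (hf : ∀ k, AEStronglyMeasurable (f k) μ) (hsum : ∑' k, ∫⁻ x, ‖f k x‖ₑ ^ p ∂μ ≠ ∞) :
    ∀ᵐ x ∂μ, Tendsto (fun k => f k x) atTop (𝓝 0) := by
  have hmeas (k : ℕ) : AEMeasurable (fun x => ‖f k x‖ₑ ^ p) μ := (hf k).enorm.pow_const p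
  rw [← lintegral_tsum hmeas] at hsum
  filter_upwards [ae_lt_top' (AEMeasurable.tsum hmeas) hsum] with x hx
  exact tendsto_zero_iff_enorm_tendsto_zero.2
    (tendsto_zero_of_tendsto_rpow_zero hp (ENNReal.tendsto_atTop_zero_of_tsum_ne_top hx.ne))

theorem exists_memLp_forall_norm_le_of_tsum_ne_top (hp : 0 < p) {f : ℕ → α → ℝ}
    (hf : ∀ k, AEStronglyMeasurable (f k) μ) (hsum : ∑' k, ∫⁻ x, ‖f k x‖ₑ ^ p ∂μ ≠ ∞) :
    ∃ b : α → ℝ, MemLp b (ENNReal.ofReal p) μ ∧ (∀ᵐ x ∂μ, ∀ k, ‖f k x‖ ≤ b x) ∧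
      ∫⁻ x, ‖b x‖ₑ ^ p ∂μ = ∑' k, ∫⁻ x, ‖f k x‖ₑ ^ p ∂μ := by
  have hmeas (k : ℕ) : AEMeasurable (fun x => ‖f k x‖ₑ ^ p) μ := (hf k).enorm.pow_const p
  set S : α → ℝ≥0∞ := fun x => ∑' k, ‖f k x‖ₑ ^ p
  have hS : AEMeasurable S μ := AEMeasurable.tsum hmeas
  rw [← lintegral_tsum hmeas] at hsum ⊢
  set b : α → ℝ := fun x => (S x ^ p⁻¹).toReal
  have hb : ∀ᵐ x ∂μ, ‖b x‖ₑ = S x ^ p⁻¹ := by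
    filter_upwards [ae_lt_top' hS hsum] with x hx
    rw [Real.enorm_of_nonneg ENNReal.toReal_nonneg, ENNReal.ofReal_toReal
      (ENNReal.rpow_ne_top_of_nonneg (inv_nonneg.2 hp.le) hx.ne)]
  have hint : ∫⁻ x, ‖b x‖ₑ ^ p ∂μ = ∫⁻ x, S x ∂μ :=
    lintegral_congr_ae (hb.mono fun x hx => by simp only [hx, ENNReal.rpow_inv_rpow hp.ne'])
  refine ⟨b, ⟨(hS.pow_const _).ennreal_toReal.aestronglyMeasurable, ?_⟩, ?_, hint⟩
  · rw [← ENNReal.rpow_lt_top_iff_of_pos hp, eLpNorm_ofReal_rpow hp, hint]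
    exact hsum.lt_top
  · filter_upwards [hb] with x hx k
    have hle : ‖f k x‖ₑ ≤ ‖b x‖ₑ := by
      rw [hx, ENNReal.le_rpow_inv_iff hp]
      exact ENNReal.le_tsum k
    simpa [b] using enorm_le_iff_norm_le.1 hle

end PowerIntegral

section WeakJet

variable {N : ℕ} {Ω : Opens (RN N)} {p : ℝ} {u v : RN N → ℝ} {J K : Option (Fin N) → RN N → ℝ}

theorem MemLpOn.locallyIntegrableOn (hp : 1 ≤ p) (hu : MemLpOn Ω p u) :
    LocallyIntegrableOn u Ω :=
  locallyIntegrableOn_of_locallyIntegrable_restrict (MemLp.locallyIntegrable hu (by simpa using hp))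

/-- `J` represents the first order jet of `u ∈ W^{1,p}(Ω)`: the component `none` is `u` itself and
the component `some i` is an `i`-th weak partial derivative of `u`. Treating a function and its
derivatives uniformly is possible because taking positive parts and maxima acts on all of them by
the same formula. -/
structure IsWeakJet (Ω : Opens (RN N)) (p : ℝ) (u : RN N → ℝ) (J : Option (Fin N) → RN N → ℝ) :
    Prop where
  none_eq : J none = u
  memLpOn : ∀ j, MemLpOn Ω p (J j)
  hasWeakPartialDeriv : ∀ i, HasWeakPartialDeriv Ω i u (J (some i))

theorem mem_sobolevSpace_iff_exists_isWeakJet :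
    u ∈ sobolevSpace Ω p ↔ ∃ J, IsWeakJet Ω p u J := by
  constructor
  · rintro ⟨hu, hderiv⟩
    choose G hG hGu using hderiv
    exact ⟨fun j => j.elim u G, rfl, fun j => by cases j <;> simp [hu, hG], hGu⟩
  · rintro ⟨J, hJ⟩
    exact ⟨hJ.none_eq ▸ hJ.memLpOn none, fun i => ⟨_, hJ.memLpOn _, hJ.hasWeakPartialDeriv i⟩⟩

namespace IsWeakJet

theorem mem_sobolevSpace (hu : IsWeakJet Ω p u J) : u ∈ sobolevSpace Ω p :=
  mem_sobolevSpace_iff_exists_isWeakJet.2 ⟨J, hu⟩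

theorem memLpOn_self (hu : IsWeakJet Ω p u J) : MemLpOn Ω p u :=
  hu.none_eq ▸ hu.memLpOn none

theorem aestronglyMeasurable (hu : IsWeakJet Ω p u J) (j : Option (Fin N)) :
    AEStronglyMeasurable (J j) (volume.restrict (Ω : Set (RN N))) :=
  (hu.memLpOn j).1

theorem ae_eq (hp : 1 ≤ p) (hJ : IsWeakJet Ω p u J) (hK : IsWeakJet Ω p u K)
    (j : Option (Fin N)) : J j =ᵐ[volume.restrict (Ω : Set (RN N))] K j := by
  cases j with
  | none => rw [hJ.none_eq, hK.none_eq]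
  | some i =>
    exact (hJ.hasWeakPartialDeriv i).ae_eq (hK.hasWeakPartialDeriv i)
      ((hJ.memLpOn _).locallyIntegrableOn hp) ((hK.memLpOn _).locallyIntegrableOn hp)

theorem sobolevNormPow_eq (hp : 1 ≤ p) (hu : IsWeakJet Ω p u J) :
    sobolevNormPow Ω p u = ∑ j, ∫⁻ x in Ω, ‖J j x‖ₑ ^ p := by
  have hp0 : 0 < p := by positivity
  have hderiv (i : Fin N) :
      weakPartialDeriv Ω p i u =ᵐ[volume.restrict (Ω : Set (RN N))] J (some i) := by
    have hex : ∃ g, MemLpOn Ω p g ∧ HasWeakPartialDeriv Ω i u g :=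
      ⟨_, hu.memLpOn _, hu.hasWeakPartialDeriv i⟩
    rw [weakPartialDeriv, dif_pos hex]
    exact hex.choose_spec.2.ae_eq (hu.hasWeakPartialDeriv i)
      (hex.choose_spec.1.locallyIntegrableOn hp) ((hu.memLpOn _).locallyIntegrableOn hp)
  rw [sobolevNormPow, Fintype.sum_option, hu.none_eq, eLpNorm_ofReal_rpow hp0]
  congr! 2 with i
  rw [eLpNorm_congr_ae (hderiv i), eLpNorm_ofReal_rpow hp0]

theorem add (hp : 1 ≤ p) (hu : IsWeakJet Ω p u J) (hv : IsWeakJet Ω p v K) :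
    IsWeakJet Ω p (u + v) (J + K) where
  none_eq := by rw [Pi.add_apply, hu.none_eq, hv.none_eq]
  memLpOn j := MemLp.add (hu.memLpOn j) (hv.memLpOn j)
  hasWeakPartialDeriv i := (hu.hasWeakPartialDeriv i).add (hv.hasWeakPartialDeriv i)
    (hu.memLpOn_self.locallyIntegrableOn hp) (hv.memLpOn_self.locallyIntegrableOn hp)
    ((hu.memLpOn _).locallyIntegrableOn hp) ((hv.memLpOn _).locallyIntegrableOn hp)

theorem neg (hu : IsWeakJet Ω p u J) : IsWeakJet Ω p (-u) (-J) where
  none_eq := by rw [Pi.neg_apply, hu.none_eq]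
  memLpOn j := MemLp.neg (hu.memLpOn j)
  hasWeakPartialDeriv i := (hu.hasWeakPartialDeriv i).neg

theorem sub (hp : 1 ≤ p) (hu : IsWeakJet Ω p u J) (hv : IsWeakJet Ω p v K) :
    IsWeakJet Ω p (u - v) (J - K) := by
  simpa only [sub_eq_add_neg] using hu.add hp hv.neg

theorem nullMeasurableSet_pos (hu : IsWeakJet Ω p u J) :
    NullMeasurableSet {x | 0 < u x} (volume.restrict (Ω : Set (RN N))) :=
  nullMeasurableSet_lt aemeasurable_const hu.memLpOn_self.1.aemeasurable

theorem posPart (hp : 1 ≤ p) (hu : IsWeakJet Ω p u J) :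
    IsWeakJet Ω p u⁺ (fun j => {x | 0 < u x}.indicator (J j)) where
  none_eq := by
    ext x
    rcases lt_or_ge 0 (u x) with hx | hx
    · simp [hx, hu.none_eq, posPart_of_nonneg hx.le]
    · simp [hx.not_gt, posPart_of_nonpos hx]
  memLpOn j := (hu.memLpOn j).mono
    ((hu.memLpOn j).1.indicator₀ hu.nullMeasurableSet_pos)
    (ae_of_all _ fun _ => norm_indicator_le_norm_self _ _)
  hasWeakPartialDeriv i := (hu.hasWeakPartialDeriv i).posPart
    (hu.memLpOn_self.locallyIntegrableOn hp) ((hu.memLpOn _).locallyIntegrableOn hp)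

theorem ae_eq_zero (hp : 1 ≤ p) (hu : IsWeakJet Ω p u J) (j : Option (Fin N)) :
    ∀ᵐ x ∂volume.restrict (Ω : Set (RN N)), u x = 0 → J j x = 0 := by
  -- The derivatives of `u = u⁺ - (-u)⁺` are unique, and those of both terms vanish on `{u = 0}`.
  have hdecomp := (hu.posPart hp).sub hp (hu.neg.posPart hp)
  rw [posPart_neg, posPart_sub_negPart] at hdecomp
  filter_upwards [hu.ae_eq hp hdecomp j] with x hx hux
  simp [hx, hux]

open Classical in
theorem sup (hp : 1 ≤ p) (hu : IsWeakJet Ω p u J) (hv : IsWeakJet Ω p v K) :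
    IsWeakJet Ω p (u ⊔ v) (fun j x => if u x < v x then K j x else J j x) := by
  have h := hu.add hp ((hv.sub hp hu).posPart hp)
  rw [← sup_eq_add_posPart_sub, sup_comm] at h
  convert h using 3 with j x
  simp only [Pi.add_apply, Pi.sub_apply, Set.indicator_apply, Set.mem_ofPred_eq, sub_pos]
  split_ifs <;> ring

theorem tendsto_lintegral_indicator_pos_sub (hp : 1 ≤ p) (hu : IsWeakJet Ω p u J)
    {v : ℕ → RN N → ℝ}
    (hv : ∀ n, NullMeasurableSet {x | 0 < v n x} (volume.restrict (Ω : Set (RN N))))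
    (hvu : ∀ᵐ x ∂volume.restrict (Ω : Set (RN N)), Tendsto (fun n => v n x) atTop (𝓝 (u x)))
    (j : Option (Fin N)) :
    Tendsto (fun n => ∫⁻ x in Ω, ‖{x | 0 < u x}.indicator (J j) x -
      {x | 0 < v n x}.indicator (J j) x‖ₑ ^ p) atTop (𝓝 0) := by
  refine tendsto_lintegral_enorm_sub_rpow_of_dominated (by positivity)
    (fun n => (hu.aestronglyMeasurable j).indicator₀ (hv n)) (MemLp.norm (hu.memLpOn j))
    (fun n => ae_of_all _ fun x => norm_indicator_le_norm_self _ _) ?_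
  filter_upwards [hvu, hu.ae_eq_zero hp j] with x hx hJ
  refine tendsto_const_nhds.congr' ?_
  rcases lt_trichotomy (u x) 0 with hux | hux | hux
  · filter_upwards [hx.eventually_lt_const hux] with n hn
    simp [hux.not_gt, hn.not_gt]
  · simp [Set.indicator_apply, hJ hux]
  · filter_upwards [hx.eventually_const_lt hux] with n hn
    simp [hux, hn]

theorem sobolevNormPow_posPart_sub_le (hp : 1 ≤ p) (hu : IsWeakJet Ω p u J)
    (hv : IsWeakJet Ω p v K) :
    sobolevNormPow Ω p (u⁺ - v⁺) ≤ 2 ^ (p - 1) *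
      ((∑ j, ∫⁻ x in Ω, ‖{x | 0 < u x}.indicator (J j) x -
        {x | 0 < v x}.indicator (J j) x‖ₑ ^ p) + sobolevNormPow Ω p (u - v)) := by
  have hp0 : 0 ≤ p := by positivity
  rw [((hu.posPart hp).sub hp (hv.posPart hp)).sobolevNormPow_eq hp,
    (hu.sub hp hv).sobolevNormPow_eq hp, ← Finset.sum_add_distrib, Finset.mul_sum]
  refine Finset.sum_le_sum fun j _ => ?_
  set d : RN N → ℝ := {x | 0 < u x}.indicator (J j) - {x | 0 < v x}.indicator (J j)
  set e : RN N → ℝ := {x | 0 < v x}.indicator (J j - K j)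
  have hsplit : {x | 0 < u x}.indicator (J j) - {x | 0 < v x}.indicator (K j) = d + e := by
    simp only [d, e, Set.indicator_sub', sub_add_sub_cancel]
  have hd : AEStronglyMeasurable d (volume.restrict (Ω : Set (RN N))) :=
    ((hu.aestronglyMeasurable j).indicator₀ hu.nullMeasurableSet_pos).sub
      ((hu.aestronglyMeasurable j).indicator₀ hv.nullMeasurableSet_pos)
  calc ∫⁻ x in Ω, ‖({x | 0 < u x}.indicator (J j) - {x | 0 < v x}.indicator (K j)) x‖ₑ ^ p
      = ∫⁻ x in Ω, ‖d x + e x‖ₑ ^ p := by rw [hsplit]; rfl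
    _ ≤ 2 ^ (p - 1) * ((∫⁻ x in Ω, ‖d x‖ₑ ^ p) + ∫⁻ x in Ω, ‖e x‖ₑ ^ p) :=
        lintegral_enorm_add_rpow_le hp hd
    _ ≤ 2 ^ (p - 1) * ((∫⁻ x in Ω, ‖d x‖ₑ ^ p) + ∫⁻ x in Ω, ‖(J j - K j) x‖ₑ ^ p) :=
        mul_le_mul' le_rfl (add_le_add le_rfl (lintegral_mono fun x =>
          ENNReal.rpow_le_rpow (enorm_indicator_le_enorm_self _ _) hp0))

end IsWeakJet

theorem sobolevNormPow_add_le (hp : 1 ≤ p) (hu : u ∈ sobolevSpace Ω p)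
    (hv : v ∈ sobolevSpace Ω p) : sobolevNormPow Ω p (u + v) ≤
      2 ^ (p - 1) * (sobolevNormPow Ω p u + sobolevNormPow Ω p v) := by
  obtain ⟨J, hJ⟩ := mem_sobolevSpace_iff_exists_isWeakJet.1 hu
  obtain ⟨K, hK⟩ := mem_sobolevSpace_iff_exists_isWeakJet.1 hv
  rw [(hJ.add hp hK).sobolevNormPow_eq hp, hJ.sobolevNormPow_eq hp, hK.sobolevNormPow_eq hp,
    ← Finset.sum_add_distrib, Finset.mul_sum]
  exact Finset.sum_le_sum fun j _ => lintegral_enorm_add_rpow_le hp (hJ.aestronglyMeasurable j)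

theorem sobolevNormPow_neg (hp : 1 ≤ p) (hu : u ∈ sobolevSpace Ω p) :
    sobolevNormPow Ω p (-u) = sobolevNormPow Ω p u := by
  obtain ⟨J, hJ⟩ := mem_sobolevSpace_iff_exists_isWeakJet.1 hu
  simp [hJ.neg.sobolevNormPow_eq hp, hJ.sobolevNormPow_eq hp]

theorem add_mem_sobolevSpace (hp : 1 ≤ p) (hu : u ∈ sobolevSpace Ω p) (hv : v ∈ sobolevSpace Ω p) :
    u + v ∈ sobolevSpace Ω p := by
  obtain ⟨J, hJ⟩ := mem_sobolevSpace_iff_exists_isWeakJet.1 hu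
  obtain ⟨K, hK⟩ := mem_sobolevSpace_iff_exists_isWeakJet.1 hv
  exact (hJ.add hp hK).mem_sobolevSpace

theorem neg_mem_sobolevSpace (hu : u ∈ sobolevSpace Ω p) : -u ∈ sobolevSpace Ω p := by
  obtain ⟨J, hJ⟩ := mem_sobolevSpace_iff_exists_isWeakJet.1 hu
  exact hJ.neg.mem_sobolevSpace

theorem sub_mem_sobolevSpace (hp : 1 ≤ p) (hu : u ∈ sobolevSpace Ω p) (hv : v ∈ sobolevSpace Ω p) :
    u - v ∈ sobolevSpace Ω p :=
  sub_eq_add_neg u v ▸ add_mem_sobolevSpace hp hu (neg_mem_sobolevSpace hv)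

theorem posPart_mem_sobolevSpace (hp : 1 ≤ p) (hu : u ∈ sobolevSpace Ω p) :
    u⁺ ∈ sobolevSpace Ω p := by
  obtain ⟨J, hJ⟩ := mem_sobolevSpace_iff_exists_isWeakJet.1 hu
  exact (hJ.posPart hp).mem_sobolevSpace

theorem sobolevNormPow_posPart_le (hp : 1 ≤ p) (hu : u ∈ sobolevSpace Ω p) :
    sobolevNormPow Ω p u⁺ ≤ sobolevNormPow Ω p u := by
  have hp0 : 0 ≤ p := by positivity
  obtain ⟨J, hJ⟩ := mem_sobolevSpace_iff_exists_isWeakJet.1 hu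
  rw [(hJ.posPart hp).sobolevNormPow_eq hp, hJ.sobolevNormPow_eq hp]
  exact Finset.sum_le_sum fun j _ => lintegral_mono fun x =>
    ENNReal.rpow_le_rpow (enorm_indicator_le_enorm_self _ _) hp0

section Convergence

variable {w : ℕ → RN N → ℝ}

theorem tendsto_sobolevNormPow_add (hp : 1 ≤ p) {w' : ℕ → RN N → ℝ}
    (hw : ∀ n, w n ∈ sobolevSpace Ω p) (hw' : ∀ n, w' n ∈ sobolevSpace Ω p)
    (hlim : Tendsto (fun n => sobolevNormPow Ω p (w n)) atTop (𝓝 0))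
    (hlim' : Tendsto (fun n => sobolevNormPow Ω p (w' n)) atTop (𝓝 0)) :
    Tendsto (fun n => sobolevNormPow Ω p (w n + w' n)) atTop (𝓝 0) := by
  have hbound : Tendsto (fun n => 2 ^ (p - 1) * (sobolevNormPow Ω p (w n) +
      sobolevNormPow Ω p (w' n))) atTop (𝓝 0) := by
    simpa using ENNReal.Tendsto.const_mul (hlim.add hlim')
      (Or.inr (two_rpow_sub_one_ne_top hp))
  exact tendsto_of_tendsto_of_tendsto_of_le_of_le tendsto_const_nhds hbound (fun _ => zero_le)
    fun n => sobolevNormPow_add_le hp (hw n) (hw' n)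

theorem tendsto_eLpNorm_of_tendsto_sobolevNormPow (hp : 0 < p)
    (hlim : Tendsto (fun n => sobolevNormPow Ω p (w n)) atTop (𝓝 0)) :
    Tendsto (fun n => eLpNorm (w n) (ENNReal.ofReal p) (volume.restrict (Ω : Set (RN N))))
      atTop (𝓝 0) :=
  tendsto_zero_of_tendsto_rpow_zero hp <|
    tendsto_of_tendsto_of_tendsto_of_le_of_le tendsto_const_nhds hlim (fun _ => zero_le)
      fun _ => le_self_add

theorem tendsto_sobolevNormPow_posPart_sub_of_tendsto_ae (hp : 1 ≤ p) (hu : u ∈ sobolevSpace Ω p)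
    (hw : ∀ n, w n ∈ sobolevSpace Ω p)
    (hlim : Tendsto (fun n => sobolevNormPow Ω p (u - w n)) atTop (𝓝 0))
    (hae : ∀ᵐ x ∂volume.restrict (Ω : Set (RN N)), Tendsto (fun n => w n x) atTop (𝓝 (u x))) :
    Tendsto (fun n => sobolevNormPow Ω p (u⁺ - (w n)⁺)) atTop (𝓝 0) := by
  obtain ⟨J, hJ⟩ := mem_sobolevSpace_iff_exists_isWeakJet.1 hu
  choose K hK using fun n => mem_sobolevSpace_iff_exists_isWeakJet.1 (hw n)
  have hindicator := tendsto_finsetSum Finset.univ fun j _ =>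
    hJ.tendsto_lintegral_indicator_pos_sub hp (fun n => (hK n).nullMeasurableSet_pos) hae j
  refine tendsto_of_tendsto_of_tendsto_of_le_of_le tendsto_const_nhds ?_ (fun _ => zero_le)
    fun n => hJ.sobolevNormPow_posPart_sub_le hp (hK n)
  simpa using ENNReal.Tendsto.const_mul (hindicator.add hlim)
    (Or.inr (two_rpow_sub_one_ne_top hp))

theorem tendsto_sobolevNormPow_posPart_sub (hp : 1 ≤ p) (hu : u ∈ sobolevSpace Ω p)
    (hw : ∀ n, w n ∈ sobolevSpace Ω p)
    (hlim : Tendsto (fun n => sobolevNormPow Ω p (u - w n)) atTop (𝓝 0)) :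
    Tendsto (fun n => sobolevNormPow Ω p (u⁺ - (w n)⁺)) atTop (𝓝 0) := by
  have hp0 : 0 < p := by positivity
  have hmeasure : TendstoInMeasure (volume.restrict (Ω : Set (RN N))) w atTop u := by
    refine tendstoInMeasure_of_tendsto_eLpNorm (ENNReal.ofReal_pos.2 hp0).ne'
      (fun n => (hw n).1.1) hu.1.1 ?_
    simpa only [eLpNorm_sub_comm] using tendsto_eLpNorm_of_tendsto_sobolevNormPow hp0 hlim
  refine tendsto_of_subseq_tendsto fun ns hns => ?_
  obtain ⟨ms, hms, hae⟩ := (hmeasure.comp hns).exists_seq_tendsto_ae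
  exact ⟨ms, tendsto_sobolevNormPow_posPart_sub_of_tendsto_ae hp hu (fun n => hw (ns (ms n)))
    (hlim.comp (hns.comp hms.tendsto_atTop)) hae⟩

end Convergence

end WeakJet

section SobolevTilde

variable {N : ℕ} {Ω : Opens (RN N)} {p : ℝ} {u v : RN N → ℝ}

theorem add_mem_sobolevCc (hp : 1 ≤ p) (hu : u ∈ sobolevCc Ω p) (hv : v ∈ sobolevCc Ω p) :
    u + v ∈ sobolevCc Ω p := by
  obtain ⟨hu, f, hf⟩ := hu
  obtain ⟨hv, g, hg⟩ := hv
  exact ⟨add_mem_sobolevSpace hp hu hv, f + g, fun x hx => by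
    rw [Pi.add_apply, hf x hx, hg x hx, CompactlySupportedContinuousMap.add_apply]⟩

theorem neg_mem_sobolevCc (hu : u ∈ sobolevCc Ω p) : -u ∈ sobolevCc Ω p := by
  obtain ⟨hu, f, hf⟩ := hu
  exact ⟨neg_mem_sobolevSpace hu, -f, fun x hx => by
    rw [Pi.neg_apply, hf x hx, CompactlySupportedContinuousMap.neg_apply]⟩

theorem posPart_mem_sobolevCc (hp : 1 ≤ p) (hu : u ∈ sobolevCc Ω p) : u⁺ ∈ sobolevCc Ω p := by
  obtain ⟨hu, f, hf⟩ := hu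
  exact ⟨posPart_mem_sobolevSpace hp hu, f ⊔ 0, fun x hx => by
    rw [Pi.posPart_apply, hf x hx, posPart_def, CompactlySupportedContinuousMap.sup_apply,
      CompactlySupportedContinuousMap.zero_apply]⟩

theorem mem_sobolevTilde_iff_exists_seq :
    u ∈ sobolevTilde Ω p ↔ u ∈ sobolevSpace Ω p ∧ ∃ w : ℕ → RN N → ℝ,
      (∀ n, w n ∈ sobolevCc Ω p) ∧
      Tendsto (fun n => sobolevNormPow Ω p (u - w n)) atTop (𝓝 0) := by
  refine and_congr_right fun _ => ⟨fun happrox => ?_, ?_⟩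
  · choose w hw hlt using fun n : ℕ => happrox (n : ℝ≥0∞)⁻¹ (by simp)
    exact ⟨w, hw, tendsto_of_tendsto_of_tendsto_of_le_of_le tendsto_const_nhds
      ENNReal.tendsto_inv_nat_nhds_zero (fun _ => zero_le) fun n => (hlt n).le⟩
  · rintro ⟨w, hw, hlim⟩ ε hε
    obtain ⟨n, hn⟩ := (hlim.eventually_lt_const hε).exists
    exact ⟨w n, hw n, hn⟩

theorem mem_sobolevTilde_of_tendsto (hp : 1 ≤ p) (hu : u ∈ sobolevSpace Ω p) {v : ℕ → RN N → ℝ}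
    (hv : ∀ n, v n ∈ sobolevTilde Ω p)
    (hlim : Tendsto (fun n => sobolevNormPow Ω p (u - v n)) atTop (𝓝 0)) :
    u ∈ sobolevTilde Ω p := by
  choose w hw hlt using fun n : ℕ => (hv n).2 (n : ℝ≥0∞)⁻¹ (by simp)
  have hvw : Tendsto (fun n => sobolevNormPow Ω p (v n - w n)) atTop (𝓝 0) :=
    tendsto_of_tendsto_of_tendsto_of_le_of_le tendsto_const_nhds
      ENNReal.tendsto_inv_nat_nhds_zero (fun _ => zero_le) fun n => (hlt n).le
  refine mem_sobolevTilde_iff_exists_seq.2 ⟨hu, w, hw, ?_⟩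
  simpa only [sub_add_sub_cancel] using tendsto_sobolevNormPow_add hp
    (fun n => sub_mem_sobolevSpace hp hu (hv n).1)
    (fun n => sub_mem_sobolevSpace hp (hv n).1 (hw n).1) hlim hvw

theorem add_mem_sobolevTilde (hp : 1 ≤ p) (hu : u ∈ sobolevTilde Ω p) (hv : v ∈ sobolevTilde Ω p) :
    u + v ∈ sobolevTilde Ω p := by
  obtain ⟨hu, a, ha, hau⟩ := mem_sobolevTilde_iff_exists_seq.1 hu
  obtain ⟨hv, b, hb, hbv⟩ := mem_sobolevTilde_iff_exists_seq.1 hv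
  refine mem_sobolevTilde_iff_exists_seq.2 ⟨add_mem_sobolevSpace hp hu hv, fun n => a n + b n,
    fun n => add_mem_sobolevCc hp (ha n) (hb n), ?_⟩
  simpa only [add_sub_add_comm] using tendsto_sobolevNormPow_add hp
    (fun n => sub_mem_sobolevSpace hp hu (ha n).1)
    (fun n => sub_mem_sobolevSpace hp hv (hb n).1) hau hbv

theorem neg_mem_sobolevTilde (hp : 1 ≤ p) (hu : u ∈ sobolevTilde Ω p) : -u ∈ sobolevTilde Ω p := by
  obtain ⟨hu, a, ha, hau⟩ := mem_sobolevTilde_iff_exists_seq.1 hu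
  refine mem_sobolevTilde_iff_exists_seq.2 ⟨neg_mem_sobolevSpace hu, fun n => -a n,
    fun n => neg_mem_sobolevCc (ha n), hau.congr fun n => ?_⟩
  rw [← neg_sub', sobolevNormPow_neg hp (sub_mem_sobolevSpace hp hu (ha n).1)]

theorem posPart_mem_sobolevTilde (hp : 1 ≤ p) (hu : u ∈ sobolevTilde Ω p) :
    u⁺ ∈ sobolevTilde Ω p := by
  obtain ⟨hu, a, ha, hau⟩ := mem_sobolevTilde_iff_exists_seq.1 hu
  exact mem_sobolevTilde_iff_exists_seq.2 ⟨posPart_mem_sobolevSpace hp hu, fun n => (a n)⁺,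
    fun n => posPart_mem_sobolevCc hp (ha n),
    tendsto_sobolevNormPow_posPart_sub hp hu (fun n => (ha n).1) hau⟩

theorem sup_mem_sobolevTilde (hp : 1 ≤ p) (hu : u ∈ sobolevTilde Ω p) (hv : v ∈ sobolevTilde Ω p) :
    u ⊔ v ∈ sobolevTilde Ω p := by
  rw [sup_eq_add_posPart_sub, sub_eq_add_neg]
  exact add_mem_sobolevTilde hp hv
    (posPart_mem_sobolevTilde hp (add_mem_sobolevTilde hp hu (neg_mem_sobolevTilde hp hv)))

end SobolevTilde

section FirstArgmax

variable {α : Type*} [LinearOrder α] {a : ℕ → α} {m n : ℕ}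

/-- The least index at which `a 0, …, a n` attain their maximum. Applied pointwise to a sequence of
functions, it also selects the derivatives of the running maximum. -/
def firstArgmax (a : ℕ → α) : ℕ → ℕ
  | 0 => 0
  | n + 1 => if a (firstArgmax a n) < a (n + 1) then n + 1 else firstArgmax a n

theorem partialSups_eq_apply_firstArgmax (a : ℕ → α) (n : ℕ) :
    partialSups a n = a (firstArgmax a n) := by
  induction n with
  | zero => rw [partialSups_zero, firstArgmax]
  | succ n ih =>
    rw [partialSups_add_one, ih, firstArgmax]
    split_ifs with h
    · exact sup_eq_right.2 h.le
    · exact sup_eq_left.2 (not_lt.1 h)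

theorem firstArgmax_eq_of_forall_ge (h : ∀ k, m ≤ k → a (k + 1) ≤ partialSups a k)
    (hmn : m ≤ n) : firstArgmax a n = firstArgmax a m := by
  induction n, hmn using Nat.le_induction with
  | base => rfl
  | succ n hn ih =>
    rw [firstArgmax, ← partialSups_eq_apply_firstArgmax a n, if_neg (h n hn).not_gt, ih]

theorem le_apply_of_eventually_firstArgmax_eq (h : ∀ᶠ n in atTop, firstArgmax a n = m) (k : ℕ) :
    a k ≤ a m := by
  obtain ⟨n, hn, hkn⟩ := (h.and (eventually_ge_atTop k)).exists
  rw [← hn, ← partialSups_eq_apply_firstArgmax a n]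
  exact le_partialSups_of_le a hkn

theorem exists_eventually_firstArgmax_eq {a : ℕ → ℝ} (ha : ∀ k, 0 ≤ a k)
    (hlim : Tendsto a atTop (𝓝 0)) : ∃ m, ∀ᶠ n in atTop, firstArgmax a n = m := by
  suffices hdom : ∃ m, ∀ k, m ≤ k → a (k + 1) ≤ partialSups a k by
    obtain ⟨m, hm⟩ := hdom
    exact ⟨firstArgmax a m, (eventually_ge_atTop m).mono fun n => firstArgmax_eq_of_forall_ge hm⟩
  by_cases hpos : ∃ i, 0 < a i
  · obtain ⟨i, hi⟩ := hpos
    obtain ⟨m, hm⟩ := eventually_atTop.1 (hlim.eventually_lt_const hi)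
    exact ⟨max i m, fun k hk => (hm _ ((le_of_max_le_right hk).trans k.le_succ)).le.trans
      (le_partialSups_of_le a (le_of_max_le_left hk))⟩
  · push Not at hpos
    exact ⟨0, fun k _ => (hpos _).trans ((ha k).trans (le_partialSups a k))⟩

theorem exists_ae_eventually_firstArgmax_eq {α : Type*} [MeasurableSpace α] {μ : Measure α} {p : ℝ}
    {u : ℕ → α → ℝ} (hp : 0 < p) (hu0 : ∀ k, 0 ≤ u k) (hu : ∀ k, AEStronglyMeasurable (u k) μ)
    (hsum : ∑' k, ∫⁻ x, ‖u k x‖ₑ ^ p ∂μ ≠ ∞) :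
    ∃ m : α → ℕ, ∀ᵐ x ∂μ, ∀ᶠ n in atTop, firstArgmax (u · x) n = m x :=
  skolem.1 ((ae_tendsto_zero_of_tsum_lintegral_enorm_rpow_ne_top hp hu hsum).mono
    fun x hx => exists_eventually_firstArgmax_eq (fun k => hu0 k x) hx)

end FirstArgmax

section Supremum

variable {N : ℕ} {Ω : Opens (RN N)} {p : ℝ}

section Dominated

variable {v : ℕ → RN N → ℝ} {K : ℕ → Option (Fin N) → RN N → ℝ}
  {u : RN N → ℝ} {J b : Option (Fin N) → RN N → ℝ}

theorem IsWeakJet.of_dominated (hp : 1 ≤ p) (hv : ∀ n, IsWeakJet Ω p (v n) (K n))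
    (hb : ∀ j, MemLpOn Ω p (b j))
    (hKb : ∀ n j, ∀ᵐ x ∂volume.restrict (Ω : Set (RN N)), ‖K n j x‖ ≤ b j x)
    (hlim : ∀ j, ∀ᵐ x ∂volume.restrict (Ω : Set (RN N)),
      Tendsto (fun n => K n j x) atTop (𝓝 (J j x))) :
    IsWeakJet Ω p (J none) J where
  none_eq := rfl
  memLpOn j := by
    refine MemLp.mono' (hb j) (aestronglyMeasurable_of_tendsto_ae atTop
      (fun n => (hv n).aestronglyMeasurable j) (hlim j)) ?_
    filter_upwards [ae_all_iff.2 fun n => hKb n j, hlim j] with x hx hxlim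
    exact le_of_tendsto hxlim.norm (Eventually.of_forall hx)
  hasWeakPartialDeriv i := HasWeakPartialDeriv.of_dominated (v := fun n => K n none)
    (fun n => (hv n).none_eq ▸ (hv n).hasWeakPartialDeriv i)
    (fun n => (hv n).aestronglyMeasurable _) (fun n => (hv n).aestronglyMeasurable _)
    (fun n => hKb n _) (fun n => hKb n _) ((hb _).locallyIntegrableOn hp)
    ((hb _).locallyIntegrableOn hp) (hlim _) (hlim _)

theorem IsWeakJet.tendsto_sobolevNormPow_sub_of_dominated (hp : 1 ≤ p) (hu : IsWeakJet Ω p u J)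
    (hv : ∀ n, IsWeakJet Ω p (v n) (K n)) (hb : ∀ j, MemLpOn Ω p (b j))
    (hKb : ∀ n j, ∀ᵐ x ∂volume.restrict (Ω : Set (RN N)), ‖K n j x‖ ≤ b j x)
    (hlim : ∀ j, ∀ᵐ x ∂volume.restrict (Ω : Set (RN N)),
      Tendsto (fun n => K n j x) atTop (𝓝 (J j x))) :
    Tendsto (fun n => sobolevNormPow Ω p (u - v n)) atTop (𝓝 0) := by
  simp_rw [fun n => (hu.sub hp (hv n)).sobolevNormPow_eq hp]
  simpa using tendsto_finsetSum Finset.univ fun j _ =>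
    tendsto_lintegral_enorm_sub_rpow_of_dominated (by positivity)
      (fun n => (hv n).aestronglyMeasurable j) (hb j) (fun n => hKb n j) (hlim j)

end Dominated

variable {u : ℕ → RN N → ℝ} {J : ℕ → Option (Fin N) → RN N → ℝ}

theorem IsWeakJet.partialSups (hp : 1 ≤ p) (hu : ∀ k, IsWeakJet Ω p (u k) (J k)) (n : ℕ) :
    IsWeakJet Ω p (partialSups u n) (fun j x => J (firstArgmax (u · x) n) j x) := by
  induction n with
  | zero => simpa only [partialSups_zero, firstArgmax] using hu 0
  | succ n ih =>
    rw [partialSups_add_one]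
    convert ih.sup hp (hu (n + 1)) using 3 with j x
    rw [firstArgmax, ← partialSups_eq_apply_firstArgmax (u · x) n, Pi.partialSups_apply]
    split_ifs <;> rfl

theorem partialSups_mem_sobolevTilde (hp : 1 ≤ p) (hu : ∀ k, u k ∈ sobolevTilde Ω p) (n : ℕ) :
    partialSups u n ∈ sobolevTilde Ω p := by
  induction n with
  | zero => exact partialSups_zero u ▸ hu 0
  | succ n ih => exact partialSups_add_one u n ▸ sup_mem_sobolevTilde hp ih (hu (n + 1))

theorem exists_mem_sobolevTilde_forall_le (hp : 1 ≤ p) (hu : ∀ k, u k ∈ sobolevTilde Ω p)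
    (hu0 : ∀ k, 0 ≤ u k) (hsum : ∑' k, sobolevNormPow Ω p (u k) ≠ ∞) :
    ∃ w ∈ sobolevTilde Ω p, sobolevNormPow Ω p w ≤ ∑' k, sobolevNormPow Ω p (u k) ∧
      ∀ᵐ x ∂volume.restrict (Ω : Set (RN N)), ∀ k, u k x ≤ w x := by
  have hp0 : 0 < p := by positivity
  choose J hJ using fun k => mem_sobolevSpace_iff_exists_isWeakJet.1 (hu k).1
  have hsum_eq : ∑' k, sobolevNormPow Ω p (u k) = ∑ j, ∑' k, ∫⁻ x in Ω, ‖J k j x‖ₑ ^ p := by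
    rw [← Summable.tsum_finsetSum fun _ _ => ENNReal.summable]
    exact tsum_congr fun k => (hJ k).sobolevNormPow_eq hp
  have hsum_ne_top (j : Option (Fin N)) : ∑' k, ∫⁻ x in Ω, ‖J k j x‖ₑ ^ p ≠ ∞ :=
    ENNReal.sum_ne_top.1 (hsum_eq ▸ hsum) j (Finset.mem_univ j)
  have hmeas (j : Option (Fin N)) (k : ℕ) := (hJ k).aestronglyMeasurable j
  choose b hb hJb hb_eq using fun j =>
    exists_memLp_forall_norm_le_of_tsum_ne_top hp0 (hmeas j) (hsum_ne_top j)
  obtain ⟨m, hm⟩ := exists_ae_eventually_firstArgmax_eq hp0 hu0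
    (fun k => (hJ k).none_eq ▸ hmeas none k)
    (by simpa only [(hJ _).none_eq] using hsum_ne_top none)
  set W : Option (Fin N) → RN N → ℝ := fun j x => J (m x) j x
  have hlim (j : Option (Fin N)) : ∀ᵐ x ∂volume.restrict (Ω : Set (RN N)),
      Tendsto (fun n => J (firstArgmax (u · x) n) j x) atTop (𝓝 (W j x)) :=
    hm.mono fun x hx => tendsto_const_nhds.congr' (hx.mono fun n hn => by simp only [W, hn])
  have hdom (n : ℕ) (j : Option (Fin N)) : ∀ᵐ x ∂volume.restrict (Ω : Set (RN N)),
      ‖J (firstArgmax (u · x) n) j x‖ ≤ b j x := (hJb j).mono fun x hx => hx _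
  have hsup := IsWeakJet.partialSups hp hJ
  have hW := IsWeakJet.of_dominated hp hsup hb hdom hlim
  refine ⟨W none, mem_sobolevTilde_of_tendsto hp hW.mem_sobolevSpace
    (partialSups_mem_sobolevTilde hp hu)
    (hW.tendsto_sobolevNormPow_sub_of_dominated hp hsup hb hdom hlim), ?_, ?_⟩
  · rw [hW.sobolevNormPow_eq hp, hsum_eq]
    refine Finset.sum_le_sum fun j _ => hb_eq j ▸ lintegral_mono_ae ((hJb j).mono fun x hx => ?_)
    exact ENNReal.rpow_le_rpow (enorm_le_iff_norm_le.2 ((hx _).trans (le_abs_self _))) hp0.le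
  · filter_upwards [hm] with x hx k
    simp only [W, (hJ _).none_eq]
    exact le_apply_of_eventually_firstArgmax_eq hx k

end Supremum

section Capacity

variable {N : ℕ} {Ω : Opens (RN N)} {p : ℝ}

theorem relCapacity_lt_iff {A : Set (closure (Ω : Set (RN N)))} {c : ℝ≥0∞} :
    relCapacity Ω p A < c ↔ ∃ u ∈ admissible Ω p A, sobolevNormPow Ω p u < c := by
  simp only [relCapacity, iInf_lt_iff, exists_prop]

theorem mem_admissible_iUnion {ι : Type*} [Countable ι] {A : ι → Set (closure (Ω : Set (RN N)))}
    {u : ι → RN N → ℝ} {w : RN N → ℝ} (hu : ∀ k, u k ∈ admissible Ω p (A k))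
    (hw : w ∈ sobolevTilde Ω p)
    (hle : ∀ᵐ x ∂volume.restrict (Ω : Set (RN N)), ∀ k, u k x ≤ w x) :
    w ∈ admissible Ω p (⋃ k, A k) := by
  choose _ O hO hAO hOu using hu
  refine ⟨hw, ⋃ k, O k, isOpen_iUnion hO, Set.iUnion_mono hAO, ?_⟩
  filter_upwards [(ae_restrict_iff' Ω.isOpen.measurableSet).1 hle, ae_all_iff.2 hOu] with x hx hxO
  rintro ⟨⟨y, hy, rfl⟩, hxΩ⟩
  obtain ⟨k, hk⟩ := Set.mem_iUnion.1 hy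
  exact (hxO k ⟨⟨y, hk, rfl⟩, hxΩ⟩).trans (hx hxΩ k)

theorem posPart_mem_admissible (hp : 1 ≤ p) {A : Set (closure (Ω : Set (RN N)))} {u : RN N → ℝ}
    (hu : u ∈ admissible Ω p A) : u⁺ ∈ admissible Ω p A := by
  obtain ⟨hut, O, hO, hAO, hOu⟩ := hu
  exact ⟨posPart_mem_sobolevTilde hp hut, O, hO, hAO,
    hOu.mono fun x hx hxO => (hx hxO).trans (le_posPart u x)⟩

theorem relCapacity_iUnion_le_tsum_sobolevNormPow (hp : 1 ≤ p)
    {A : ℕ → Set (closure (Ω : Set (RN N)))} {u : ℕ → RN N → ℝ}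
    (hu : ∀ k, u k ∈ admissible Ω p (A k)) :
    relCapacity Ω p (⋃ k, A k) ≤ ∑' k, sobolevNormPow Ω p (u k) := by
  have hposPart_le : ∑' k, sobolevNormPow Ω p (u k)⁺ ≤ ∑' k, sobolevNormPow Ω p (u k) :=
    ENNReal.tsum_le_tsum fun k => sobolevNormPow_posPart_le hp (hu k).1.1
  have hposPart (k : ℕ) := posPart_mem_admissible hp (hu k)
  rcases eq_or_ne (∑' k, sobolevNormPow Ω p (u k)⁺) ∞ with htop | hfin
  · exact le_top.trans (htop ▸ hposPart_le)
  obtain ⟨w, hw, hw_le, hle_w⟩ := exists_mem_sobolevTilde_forall_le hp (fun k => (hposPart k).1)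
    (fun k => posPart_nonneg (u k)) hfin
  exact (iInf₂_le w (mem_admissible_iUnion hposPart hw hle_w)).trans (hw_le.trans hposPart_le)

end Capacity

end RelCap

open RelCap in
theorem mainTheorem5_general {N : ℕ} (Ω : Opens (RN N)) (p : ℝ) (hp : 1 ≤ p)
    (A : ℕ → Set (closure (Ω : Set (RN N)))) :
    relCapacity Ω p (⋃ k, A k) ≤ ∑' k, relCapacity Ω p (A k) := by
  refine ENNReal.le_of_forall_pos_le_add fun ε hε hfin => ?_
  obtain ⟨δ, hδ, hδε⟩ := ENNReal.exists_pos_sum_of_countable' (ENNReal.coe_pos.2 hε).ne' ℕ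
  have hlt (k : ℕ) : relCapacity Ω p (A k) < relCapacity Ω p (A k) + δ k :=
    ENNReal.lt_add_right (ENNReal.ne_top_of_tsum_ne_top hfin.ne k) (hδ k).ne'
  choose u hu hu_lt using fun k => relCapacity_lt_iff.1 (hlt k)
  calc relCapacity Ω p (⋃ k, A k)
      ≤ ∑' k, sobolevNormPow Ω p (u k) := relCapacity_iUnion_le_tsum_sobolevNormPow hp hu
    _ ≤ ∑' k, (relCapacity Ω p (A k) + δ k) := ENNReal.tsum_le_tsum fun k => (hu_lt k).le
    _ = ∑' k, relCapacity Ω p (A k) + ∑' k, δ k := ENNReal.tsum_add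
    _ ≤ ∑' k, relCapacity Ω p (A k) + ε := by gcongr

theorem mainTheorem5 {N : ℕ} (Ω : Opens (RelCap.RN N)) (p : ℝ) (hp : 1 < p)
    (A : ℕ → Set (closure (Ω : Set (RelCap.RN N)))) :
    RelCap.relCapacity Ω p (⋃ k, A k) ≤ ∑' k, RelCap.relCapacity Ω p (A k) :=
  mainTheorem5_general Ω p hp.le A
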